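/- Let $\mathbb K$ be an algebraically closed field of characteristic zero; all Lie superalgebras are finite-dimensional over $\mathbb K$. A quadratic Lie superalgebra $(\mathfrak g,B)$ is a Lie superalgebra $\mathfrak g=\mathfrak g_{\bar 0}\oplus\mathfrak g_{\bar 1}$ with an even, supersymmetric, non-degenerate bilinear form $B$ that is invariant: $B([X,Y],Z)=B(X,[Y,Z])$. An isometry is an even isomorphism of Lie superalgebras that preserves the forms. A Lie superalgebra is simple if its bracket is non-zero and it has no graded ideal other than $\{0\}$ and itself. Let $\mathcal B$ consist of $\{0\}$, the quadratic simple Lie superalgebras and the one-dimensional (even) Lie algebra with any non-degenerate form, up to isometry. Let $\mathcal N=\mathcal N_{\bar 1}$ be the one-dimensional odd Lie superalgebra (with zero bracket). *Generalized double extension.* Let $(\mathfrak g_1,B_1)$ be a quadratic Lie superalgebra and $\mathfrak g_2$ a Lie superalgebra. For homogeneous arguments, let $A.F=-(-1)^{|A||F|}F\circ\mathrm{ad}_{\mathfrak g_2}(A)$ be the coadjoint action of $\mathfrak g_2$ on $\mathfrak g_2^*$, and let $\mathrm{Der}_a(\mathfrak g_1)$ be the superderivations of $\mathfrak g_1$ that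 are superantisymmetric with respect to $B_1$. A context consists of an even linear map $\phi:\mathfrak g_2\to\mathrm{Der}_a(\mathfrak g_1)$ and even bilinear superantisymmetric maps $\psi:\mathfrak g_2\times\mathfrak g_2\to\mathfrak g_1$ and $w:\mathfrak g_2\times\mathfrak g_2\to\mathfrak g_2^*$ such that, for all homogeneous $A,B,C\in\mathfrak g_2$, $$[\phi(A),\phi(B)]-\phi([A,B])=\mathrm{ad}_{\mathfrak g_1}(\psi(A,B)),$$ $$\sum_{\mathrm{cyclic}}(-1)^{|C||A|}\bigl(\phi(A)(\psi(B,C))-\psi([A,B],C)\bigr)=0,$$ $$\sum_{\mathrm{cyclic}}(-1)^{|C||A|}\bigl(A.w(B,C)+w(A,[B,C])+\chi(A,\psi(B,C))\bigr)=0,$$ $$w(A,B)(C)=(-1)^{(|B|+|C|)|A|}\,w(B,C)(A),$$ where $\chi(A,X)(B)=-(-1)^{|X||B|}B_1(\psi(A,B),X)$. Put $\Phi(X,Y)(A)=(-1)^{|A|(|X|+|Y|)}B_1(\phi(A)(X),Y)$. The generalized double extension of $(\mathfrak g_1,B_1)$ by $\mathfrak g_2$ by means of $(\phi,\psi,w)$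 is $\mathfrak g_2\oplus\mathfrak g_1\oplus\mathfrak g_2^*$ with, for homogeneous $A+X+F$ of degree $a$ and $B+Y+H$ of degree $b$, $$\begin{aligned}[A+X+F,\,B+Y+H]=\;&[A,B]+[X,Y]+\psi(A,B)+\phi(A)(Y)-(-1)^{ab}\phi(B)(X)+\Phi(X,Y)\\&+A.H-(-1)^{ab}B.F+\chi(A,Y)-(-1)^{ab}\chi(B,X)+w(A,B)\end{aligned}$$ and the form sending the pair $(A+X+F,\;B+Y+H)$ to $B_1(X,Y)+F(B)+(-1)^{ab}H(A)$. **Theorem.** Let $(\mathfrak g,B)$ be a quadratic Lie superalgebra. Then either $(\mathfrak g,B)$ is an element of $\mathcal B$, or $(\mathfrak g,B)$ is obtained, up to isometry, from a finite number of elements of $\mathcal B$ by a finite sequence of orthogonal direct sums of quadratic Lie superalgebras and/or generalized double extensions, each of them by a simple Lie superalgebra, by the one-dimensional Lie algebra, or by $\mathcal N$. -/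

import Mathlib

universe u v

/-- The sign `(-1)^{ij}` for degrees `i, j` in `ℤ/2`. -/
def superSign (K : Type v) [Field K] (i j : ZMod 2) : K := (-1) ^ (i.val * j.val)

/-- A finite-dimensional Lie superalgebra over a field `K` (of characteristic different from
`2` and `3`, so that the axioms below are the full set of axioms). `grade 0` and `grade 1` are
the even and the odd part. -/
structure LieSuperalgebra (K : Type v) [Field K] where
  carrier : Type u
  [addCommGroup : AddCommGroup carrier]
  [module : Module K carrier]
  [finiteDimensional : FiniteDimensional K carrier]
  grade : ZMod 2 → Submodule K carrier
  isCompl_grade : IsCompl (grade 0) (grade 1)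
  bracket : carrier →ₗ[K] carrier →ₗ[K] carrier
  bracket_mem : ∀ {i j : ZMod 2} {x y : carrier},
    x ∈ grade i → y ∈ grade j → bracket x y ∈ grade (i + j)
  bracket_skew : ∀ {i j : ZMod 2} {x y : carrier},
    x ∈ grade i → y ∈ grade j → bracket x y = -(superSign K i j • bracket y x)
  bracket_jacobi : ∀ {i j k : ZMod 2} {x y z : carrier},
    x ∈ grade i → y ∈ grade j → z ∈ grade k →
      superSign K i k • bracket x (bracket y z) + superSign K j i • bracket y (bracket z x)
        + superSign K k j • bracket z (bracket x y) = 0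

attribute [instance] LieSuperalgebra.addCommGroup LieSuperalgebra.module
  LieSuperalgebra.finiteDimensional

namespace LieSuperalgebra

variable {K : Type v} [Field K]

theorem isCompl_grade' (L : LieSuperalgebra.{u} K) (i : ZMod 2) :
    IsCompl (L.grade i) (L.grade (i + 1)) := by
  fin_cases i
  · exact L.isCompl_grade
  · exact L.isCompl_grade.symm

/-- The projection onto the homogeneous part of degree `i`, along the other one. -/
noncomputable def proj (L : LieSuperalgebra.{u} K) (i : ZMod 2) : L.carrier →ₗ[K] L.carrier :=
  (L.grade i).projection (L.grade (i + 1)) (L.isCompl_grade' i)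

theorem proj_of_mem (L : LieSuperalgebra.{u} K) {i : ZMod 2} {x : L.carrier}
    (hx : x ∈ L.grade i) (j : ZMod 2) : L.proj j x = if j = i then x else 0 := by
  have hij : j = i ∨ j + 1 = i :=
    (by decide : ∀ i j : ZMod 2, j = i ∨ j + 1 = i) i j
  rcases hij with rfl | rfl
  · rw [if_pos rfl]
    exact Submodule.projection_apply_of_mem_left (L.isCompl_grade' j) hx
  · rw [if_neg ((by decide : ∀ i : ZMod 2, i ≠ i + 1) j)]
    exact Submodule.projection_apply_of_mem_right (L.isCompl_grade' j) hx

/-- The grading of the dual space: a functional has degree `i` if it vanishes on the homogeneous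
elements of degree different from `i`. -/
def dualGrade (L : LieSuperalgebra.{u} K) (i : ZMod 2) : Submodule K (Module.Dual K L.carrier) :=
  (L.grade (i + 1)).dualAnnihilator

theorem comp_proj_of_mem (L : LieSuperalgebra.{u} K) {i : ZMod 2} {F : Module.Dual K L.carrier}
    (hF : F ∈ L.dualGrade i) (j : ZMod 2) : F ∘ₗ L.proj j = if j = i then F else 0 := by
  have h0 : ∀ x ∈ L.grade (i + 1), F x = 0 := (Submodule.mem_dualAnnihilator F).1 hF
  ext x
  obtain ⟨a, ha, b, hb, rfl⟩ := Submodule.mem_sup.1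
    ((L.isCompl_grade' i).sup_eq_top ▸ Submodule.mem_top (x := x))
  have hij : j = i ∨ j = i + 1 :=
    (by decide : ∀ i j : ZMod 2, j = i ∨ j = i + 1) i j
  have hne : i ≠ i + 1 := (by decide : ∀ i : ZMod 2, i ≠ i + 1) i
  rcases hij with rfl | rfl
  · simp [L.proj_of_mem ha, L.proj_of_mem hb, hne, h0 b hb]
  · simp [L.proj_of_mem ha, L.proj_of_mem hb, h0 b hb]

/-- The coadjoint representation `A.F = -(-1)^{|A||F|} F ∘ ad A` (`A`, `F` homogeneous), extended
bilinearly. -/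
noncomputable def coadjoint (L : LieSuperalgebra.{u} K) :
    L.carrier →ₗ[K] Module.Dual K L.carrier →ₗ[K] Module.Dual K L.carrier :=
  LinearMap.mk₂ K
    (fun A F => -∑ i : ZMod 2, ∑ j : ZMod 2,
      superSign K i j • ((F ∘ₗ L.proj j) ∘ₗ L.bracket (L.proj i A)))
    (by intros; ext; simp [Finset.sum_add_distrib, mul_add]; ring)
    (by intros; ext; simp [Finset.mul_sum, mul_left_comm])
    (by intros; ext; simp [Finset.sum_add_distrib, mul_add]; ring)
    (by intros; ext; simp [Finset.mul_sum, mul_left_comm])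

theorem coadjoint_apply (L : LieSuperalgebra.{u} K) {i j : ZMod 2} {A : L.carrier}
    {F : Module.Dual K L.carrier} (hA : A ∈ L.grade i) (hF : F ∈ L.dualGrade j) :
    L.coadjoint A F = -(superSign K i j • (F ∘ₗ L.bracket A)) := by
  have h : L.coadjoint A F = -∑ i' : ZMod 2, ∑ j' : ZMod 2,
      superSign K i' j' • ((F ∘ₗ L.proj j') ∘ₗ L.bracket (L.proj i' A)) := rfl
  rw [h, Finset.sum_eq_single i, Finset.sum_eq_single j]
  · rw [L.comp_proj_of_mem hF, L.proj_of_mem hA, if_pos rfl, if_pos rfl]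
  · intro b _ hb
    rw [L.comp_proj_of_mem hF, if_neg hb]; simp
  · simp
  · intro b _ hb
    simp [L.proj_of_mem hA, hb]
  · simp

/-- A graded ideal. (For a graded subspace, left and right ideals are the same.) -/
structure IsGradedIdeal (L : LieSuperalgebra.{u} K) (I : Submodule K L.carrier) : Prop where
  graded : ∀ x ∈ I, ∀ i : ZMod 2, L.proj i x ∈ I
  bracket_mem : ∀ x : L.carrier, ∀ y ∈ I, L.bracket x y ∈ I

/-- Simple: the bracket is not zero and there is no graded ideal other than `0` and the whole. -/
def IsSimple (L : LieSuperalgebra.{u} K) : Prop :=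
  L.bracket ≠ 0 ∧ ∀ I : Submodule K L.carrier, L.IsGradedIdeal I → I = ⊥ ∨ I = ⊤

/-- The one-dimensional Lie algebra: dimension one, concentrated in even degree. (The bracket is
then zero by antisymmetry.) -/
def IsOneDimensionalLieAlgebra (L : LieSuperalgebra.{u} K) : Prop :=
  Module.finrank K L.carrier = 1 ∧ L.grade 1 = ⊥

/-- The one-dimensional odd Lie superalgebra `𝒩 = 𝒩_1`. (The bracket is then zero, as its values
are even.) -/
def IsOneDimensionalOdd (L : LieSuperalgebra.{u} K) : Prop :=
  Module.finrank K L.carrier = 1 ∧ L.grade 0 = ⊥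

end LieSuperalgebra

/-- A quadratic Lie superalgebra `(g, B)`: `form` is an even, supersymmetric, non-degenerate,
invariant bilinear form. -/
structure QuadraticLieSuperalgebra (K : Type v) [Field K] extends LieSuperalgebra.{u} K where
  form : LinearMap.BilinForm K carrier
  form_supersymmetric : ∀ {i j : ZMod 2} {x y : carrier},
    x ∈ grade i → y ∈ grade j → form x y = superSign K i j * form y x
  form_even : ∀ {x y : carrier}, x ∈ grade 0 → y ∈ grade 1 → form x y = 0
  form_nondegenerate : form.Nondegenerate
  form_invariant : ∀ x y z : carrier, form (bracket x y) z = form x (bracket y z)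

namespace QuadraticLieSuperalgebra

variable {K : Type v} [Field K]

/-- `D` is a superderivation of degree `a` which is superantisymmetric for the form: a homogeneous
element of degree `a` of `Der_a(g)`. -/
structure IsSkewSuperderivation (P : QuadraticLieSuperalgebra.{u} K) (a : ZMod 2)
    (D : Module.End K P.carrier) : Prop where
  map_mem : ∀ {i : ZMod 2} {x : P.carrier}, x ∈ P.grade i → D x ∈ P.grade (a + i)
  leibniz : ∀ {i : ZMod 2} {x : P.carrier} (y : P.carrier), x ∈ P.grade i →
    D (P.bracket x y) = P.bracket (D x) y + superSign K a i • P.bracket x (D y)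
  skew : ∀ {i : ZMod 2} {x : P.carrier} (y : P.carrier), x ∈ P.grade i →
    P.form (D x) y = -(superSign K a i * P.form x (D y))

/-- Two quadratic Lie superalgebras are isometric: there is an even isomorphism of Lie
superalgebras that preserves the forms. -/
def Isometric (Q R : QuadraticLieSuperalgebra.{u} K) : Prop :=
  ∃ e : Q.carrier ≃ₗ[K] R.carrier,
    (∀ (i : ZMod 2) (x : Q.carrier), x ∈ Q.grade i ↔ e x ∈ R.grade i) ∧
    (∀ x y, e (Q.bracket x y) = R.bracket (e x) (e y)) ∧
    (∀ x y, Q.form x y = R.form (e x) (e y))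

/-- `R` is (isometric to) the orthogonal direct sum of `P` and `Q`. -/
def IsOrthogonalDirectSum (R P Q : QuadraticLieSuperalgebra.{u} K) : Prop :=
  ∃ e : R.carrier ≃ₗ[K] P.carrier × Q.carrier,
    (∀ (i : ZMod 2) (x : R.carrier), x ∈ R.grade i ↔ e x ∈ (P.grade i).prod (Q.grade i)) ∧
    (∀ x y, e (R.bracket x y) = (P.bracket (e x).1 (e y).1, Q.bracket (e x).2 (e y).2)) ∧
    (∀ x y, R.form x y = P.form (e x).1 (e y).1 + Q.form (e x).2 (e y).2)

/-- For a bilinear map `ψ : g₂ × g₂ → g₁`, the bilinear map `χ : g₂ × g₁ → g₂*` with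
`χ(A, X)(B) = -(-1)^{|X||B|} B₁(ψ(A, B), X)` for homogeneous `X`, `B`. -/
noncomputable def chi (P : QuadraticLieSuperalgebra.{u} K) (L : LieSuperalgebra.{u} K)
    (ψ : L.carrier →ₗ[K] L.carrier →ₗ[K] P.carrier) :
    L.carrier →ₗ[K] P.carrier →ₗ[K] Module.Dual K L.carrier :=
  LinearMap.mk₂ K
    (fun A X => -∑ i : ZMod 2, ∑ j : ZMod 2,
      superSign K i j • (P.form.flip (P.proj i X) ∘ₗ ψ A ∘ₗ L.proj j))
    (by intros; ext; simp [Finset.sum_add_distrib, mul_add]; ring)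
    (by intros; ext; simp [Finset.mul_sum, mul_left_comm])
    (by intros; ext; simp [Finset.sum_add_distrib, mul_add]; ring)
    (by intros; ext; simp [Finset.mul_sum, mul_left_comm])

theorem chi_apply (P : QuadraticLieSuperalgebra.{u} K) (L : LieSuperalgebra.{u} K)
    (ψ : L.carrier →ₗ[K] L.carrier →ₗ[K] P.carrier) {i j : ZMod 2} (A : L.carrier)
    {X : P.carrier} {B : L.carrier} (hX : X ∈ P.grade i) (hB : B ∈ L.grade j) :
    P.chi L ψ A X B = -(superSign K i j * P.form (ψ A B) X) := by
  have h : P.chi L ψ A X = -∑ i' : ZMod 2, ∑ j' : ZMod 2,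
      superSign K i' j' • (P.form.flip (P.proj i' X) ∘ₗ ψ A ∘ₗ L.proj j') := rfl
  rw [h]
  rw [LinearMap.neg_apply, LinearMap.sum_apply, Finset.sum_eq_single i]
  · rw [LinearMap.sum_apply, Finset.sum_eq_single j]
    · simp [P.proj_of_mem hX, L.proj_of_mem hB]
    · intro b _ hb
      simp [L.proj_of_mem hB, hb]
    · simp
  · intro b _ hb
    simp [P.proj_of_mem hX, hb]
  · simp

/-- For a linear map `φ : g₂ → End(g₁)`, the bilinear map `Φ : g₁ × g₁ → g₂*` with
`Φ(X, Y)(A) = (-1)^{|A|(|X|+|Y|)} B₁(φ(A)(X), Y)` for homogeneous `X`, `Y`, `A`. -/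
noncomputable def Phi (P : QuadraticLieSuperalgebra.{u} K) (L : LieSuperalgebra.{u} K)
    (φ : L.carrier →ₗ[K] Module.End K P.carrier) :
    P.carrier →ₗ[K] P.carrier →ₗ[K] Module.Dual K L.carrier :=
  LinearMap.mk₂ K
    (fun X Y => ∑ i : ZMod 2, ∑ j : ZMod 2, ∑ k : ZMod 2,
      superSign K k (i + j) •
        (P.form.flip (P.proj j Y) ∘ₗ LinearMap.applyₗ (P.proj i X) ∘ₗ φ ∘ₗ L.proj k))
    (by intros; ext; simp [Finset.sum_add_distrib, mul_add])
    (by intros; ext; simp [Finset.mul_sum, mul_left_comm])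
    (by intros; ext; simp [Finset.sum_add_distrib, mul_add])
    (by intros; ext; simp [Finset.mul_sum, mul_left_comm])

theorem Phi_apply (P : QuadraticLieSuperalgebra.{u} K) (L : LieSuperalgebra.{u} K)
    (φ : L.carrier →ₗ[K] Module.End K P.carrier) {i j k : ZMod 2}
    {X Y : P.carrier} {A : L.carrier} (hX : X ∈ P.grade i) (hY : Y ∈ P.grade j)
    (hA : A ∈ L.grade k) :
    P.Phi L φ X Y A = superSign K k (i + j) * P.form (φ A X) Y := by
  have h : P.Phi L φ X Y = ∑ i' : ZMod 2, ∑ j' : ZMod 2, ∑ k' : ZMod 2,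
      superSign K k' (i' + j') •
        (P.form.flip (P.proj j' Y) ∘ₗ LinearMap.applyₗ (P.proj i' X) ∘ₗ φ ∘ₗ L.proj k') := rfl
  rw [h]
  rw [LinearMap.sum_apply, Finset.sum_eq_single i]
  · rw [LinearMap.sum_apply, Finset.sum_eq_single j]
    · rw [LinearMap.sum_apply, Finset.sum_eq_single k]
      · simp [P.proj_of_mem hX, P.proj_of_mem hY, L.proj_of_mem hA]
      · intro b _ hb
        simp [L.proj_of_mem hA, hb]
      · simp
    · intro b _ hb
      simp [P.proj_of_mem hY, hb]
    · simp
  · intro b _ hb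
    simp [P.proj_of_mem hX, hb]
  · simp

/-- A context of generalized double extension of the quadratic Lie superalgebra `P = (g₁, B₁)` by
the Lie superalgebra `L = g₂`: even maps `φ : g₂ → Der_a(g₁)`, `ψ : g₂ × g₂ → g₁`,
`w : g₂ × g₂ → g₂*`, with `ψ`, `w` bilinear and superantisymmetric, subject to the twisted morphism
condition, the Jacobi-type condition for `ψ`, the twisted cocycle condition and the supercyclicity
condition for `w`. -/
structure GDEContext (P : QuadraticLieSuperalgebra.{u} K) (L : LieSuperalgebra.{u} K) where
  φ : L.carrier →ₗ[K] Module.End K P.carrier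
  ψ : L.carrier →ₗ[K] L.carrier →ₗ[K] P.carrier
  w : L.carrier →ₗ[K] L.carrier →ₗ[K] Module.Dual K L.carrier
  φ_mem : ∀ {a : ZMod 2} {A : L.carrier}, A ∈ L.grade a → P.IsSkewSuperderivation a (φ A)
  ψ_mem : ∀ {a b : ZMod 2} {A B : L.carrier},
    A ∈ L.grade a → B ∈ L.grade b → ψ A B ∈ P.grade (a + b)
  ψ_skew : ∀ {a b : ZMod 2} {A B : L.carrier},
    A ∈ L.grade a → B ∈ L.grade b → ψ A B = -(superSign K a b • ψ B A)
  w_mem : ∀ {a b : ZMod 2} {A B : L.carrier},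
    A ∈ L.grade a → B ∈ L.grade b → w A B ∈ L.dualGrade (a + b)
  w_skew : ∀ {a b : ZMod 2} {A B : L.carrier},
    A ∈ L.grade a → B ∈ L.grade b → w A B = -(superSign K a b • w B A)
  twisted_morphism : ∀ {a b : ZMod 2} {A B : L.carrier},
    A ∈ L.grade a → B ∈ L.grade b →
      (φ A ∘ₗ φ B - superSign K a b • (φ B ∘ₗ φ A)) - φ (L.bracket A B) = P.bracket (ψ A B)
  ψ_cyclic : ∀ {a b c : ZMod 2} {A B C : L.carrier},
    A ∈ L.grade a → B ∈ L.grade b → C ∈ L.grade c →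
      superSign K c a • (φ A (ψ B C) - ψ (L.bracket A B) C)
        + superSign K a b • (φ B (ψ C A) - ψ (L.bracket B C) A)
        + superSign K b c • (φ C (ψ A B) - ψ (L.bracket C A) B) = 0
  w_cocycle : ∀ {a b c : ZMod 2} {A B C : L.carrier},
    A ∈ L.grade a → B ∈ L.grade b → C ∈ L.grade c →
      superSign K c a •
          (L.coadjoint A (w B C) + w A (L.bracket B C) + P.chi L ψ A (ψ B C))
        + superSign K a b •
          (L.coadjoint B (w C A) + w B (L.bracket C A) + P.chi L ψ B (ψ C A))
        + superSign K b c •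
          (L.coadjoint C (w A B) + w C (L.bracket A B) + P.chi L ψ C (ψ A B)) = 0
  w_supercyclic : ∀ {a b c : ZMod 2} {A B C : L.carrier},
    A ∈ L.grade a → B ∈ L.grade b → C ∈ L.grade c →
      w A B C = superSign K (b + c) a * w B C A

/-- The homogeneous elements `A + X + F` of degree `i` of `g₂ ⊕ g₁ ⊕ g₂*`. -/
def gdeGrade (P : QuadraticLieSuperalgebra.{u} K) (L : LieSuperalgebra.{u} K) (i : ZMod 2) :
    Submodule K (L.carrier × P.carrier × Module.Dual K L.carrier) :=
  (L.grade i).prod ((P.grade i).prod (L.dualGrade i))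

/-- The bracket of the generalized double extension on `g₂ ⊕ g₁ ⊕ g₂*`, for two homogeneous
elements `x = A + X + F` and `y = B + Y + H` of degrees `i` and `j`. -/
noncomputable def GDEContext.bracket {P : QuadraticLieSuperalgebra.{u} K} {L : LieSuperalgebra.{u} K}
    (c : GDEContext P L) (i j : ZMod 2)
    (x y : L.carrier × P.carrier × Module.Dual K L.carrier) :
    L.carrier × P.carrier × Module.Dual K L.carrier :=
  match x, y with
  | (A, X, F), (B, Y, H) =>
    (L.bracket A B,
      P.bracket X Y + c.ψ A B + c.φ A Y - superSign K i j • c.φ B X,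
      P.Phi L c.φ X Y + L.coadjoint A H - superSign K i j • L.coadjoint B F
        + P.chi L c.ψ A Y - superSign K i j • P.chi L c.ψ B X + c.w A B)

/-- The form of the generalized double extension on `g₂ ⊕ g₁ ⊕ g₂*`, for two homogeneous elements
`x = A + X + F` and `y = B + Y + H` of degrees `i` and `j`. -/
def gdeForm (P : QuadraticLieSuperalgebra.{u} K) (L : LieSuperalgebra.{u} K) (i j : ZMod 2)
    (x y : L.carrier × P.carrier × Module.Dual K L.carrier) : K :=
  match x, y with
  | (A, X, F), (B, Y, H) => P.form X Y + F B + superSign K i j * H A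

/-- `R` is (isometric to) a generalized double extension of `P` by `L`: for some context, there is
an even linear isomorphism of `R` with `g₂ ⊕ g₁ ⊕ g₂*` carrying the bracket and the form of `R` to
those of the generalized double extension. As usual, bracket and form are given on homogeneous
elements, which determines them by bilinearity. -/
def IsGeneralizedDoubleExtension (R P : QuadraticLieSuperalgebra.{u} K)
    (L : LieSuperalgebra.{u} K) : Prop :=
  ∃ (c : GDEContext P L)
    (e : R.carrier ≃ₗ[K] L.carrier × P.carrier × Module.Dual K L.carrier),
    (∀ (i : ZMod 2) (x : R.carrier), x ∈ R.grade i ↔ e x ∈ P.gdeGrade L i) ∧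
    (∀ (i j : ZMod 2) (x y : R.carrier), x ∈ R.grade i → y ∈ R.grade j →
      e (R.bracket x y) = c.bracket i j (e x) (e y)) ∧
    (∀ (i j : ZMod 2) (x y : R.carrier), x ∈ R.grade i → y ∈ R.grade j →
      R.form x y = P.gdeForm L i j (e x) (e y))

/-- Membership in `𝓑`: `{0}`, the quadratic simple Lie superalgebras, and the one-dimensional Lie
algebra. -/
def MemB (Q : QuadraticLieSuperalgebra.{u} K) : Prop :=
  Subsingleton Q.carrier ∨ Q.IsSimple ∨ Q.IsOneDimensionalLieAlgebra

/-- The quadratic Lie superalgebras obtained from the members of `S` (up to isometry) by finitely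
many successive orthogonal direct sums and generalized double extensions by a simple Lie
superalgebra, by the one-dimensional Lie algebra or by the one-dimensional odd Lie superalgebra. -/
inductive ObtainedFrom (S : Set (QuadraticLieSuperalgebra.{u} K)) :
    QuadraticLieSuperalgebra.{u} K → Prop
  | base {P Q : QuadraticLieSuperalgebra.{u} K} : P ∈ S → Isometric Q P → ObtainedFrom S Q
  | orthogonalSum {P Q R : QuadraticLieSuperalgebra.{u} K} :
      ObtainedFrom S P → ObtainedFrom S Q → IsOrthogonalDirectSum R P Q → ObtainedFrom S R
  | extension {P R : QuadraticLieSuperalgebra.{u} K} (L : LieSuperalgebra.{u} K) :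
      ObtainedFrom S P →
      (L.IsSimple ∨ L.IsOneDimensionalLieAlgebra ∨ L.IsOneDimensionalOdd) →
      IsGeneralizedDoubleExtension R P L → ObtainedFrom S R

end QuadraticLieSuperalgebra

/-! Induction on dimension. Let `I` be a minimal non-zero graded ideal of `g`. By invariance `I^⊥`
is a graded ideal commuting with `I`, and `I ∩ I^⊥` is `0` or `I` by minimality.

If it is `0`, either `I = g`, and `g` has no proper graded ideal, so it is simple or a line
(`simple_or_one_dimensional`), the odd line being excluded because it carries no non-degenerate
supersymmetric form; or `g = I ⊕ I^⊥` with two smaller summands (`exists_isOrthogonalDirectSum`).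

If it is `I`, then `I` is isotropic. Choose a graded isotropic complement `g₂` of `I^⊥` and put `g₁
= (I ⊕ g₂)^⊥`. The form identifies `I` with `g₂*`, while `g₂ ≅ g/I^⊥` and `g₁ ≅ I^⊥/I` inherit
brackets. The components of the bracket of `g` along `g = g₂ ⊕ g₁ ⊕ I` are `φ`, `ψ`, `w` and maps
that invariance forces to be the coadjoint action, `χ` and `Φ`; the axioms of a context are
components of the Jacobi identity and of invariance
(`IsotropicSplitting.isGeneralizedDoubleExtension`). Taking orthogonals turns graded ideals of
`g/I^⊥` into graded ideals of `g` inside `I`, so minimality makes `g₂` simple or one-dimensional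
(`exists_isGeneralizedDoubleExtension`). -/

section SuperSign

variable (K : Type v) [Field K]

theorem superSign_comm (i j : ZMod 2) : superSign K i j = superSign K j i := by
  rw [superSign, superSign, mul_comm]

theorem superSign_mul_self (i j : ZMod 2) : superSign K i j * superSign K i j = 1 := by
  rw [superSign, ← mul_pow]; simp

theorem superSign_add_right (i j k : ZMod 2) :
    superSign K i (j + k) = superSign K i j * superSign K i k := by
  -- `ZMod.val` is additive only modulo 2, which is enough for an exponent of `-1`.
  have h : ∀ i j k : ZMod 2, (i.val * (j + k).val) % 2 = (i.val * j.val + i.val * k.val) % 2 := by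
    decide
  rw [superSign, superSign, superSign, ← pow_add, neg_one_pow_eq_pow_mod_two, h,
    ← neg_one_pow_eq_pow_mod_two]

theorem superSign_ne_zero (i j : ZMod 2) : superSign K i j ≠ 0 :=
  pow_ne_zero _ (neg_ne_zero.2 one_ne_zero)

end SuperSign

/-! ### Homogeneous components, compression by an idempotent, graded ideals -/

namespace LieSuperalgebra

variable {K : Type v} [Field K] (L : LieSuperalgebra.{u} K)

theorem proj_mem (i : ZMod 2) (x : L.carrier) : L.proj i x ∈ L.grade i :=
  Submodule.projection_apply_mem (L.isCompl_grade' i) x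

theorem proj_add_proj (x : L.carrier) : L.proj 0 x + L.proj 1 x = x :=
  Submodule.projection_add_projection_eq_self L.isCompl_grade x

theorem homogeneous_induction {p : L.carrier → Prop}
    (hom : ∀ (i : ZMod 2), ∀ x ∈ L.grade i, p x) (add : ∀ x y, p x → p y → p (x + y))
    (x : L.carrier) : p x := by
  rw [← L.proj_add_proj x]
  exact add _ _ (hom 0 _ (L.proj_mem 0 x)) (hom 1 _ (L.proj_mem 1 x))

theorem mem_grade_iff {i : ZMod 2} {x : L.carrier} : x ∈ L.grade i ↔ L.proj i x = x :=
  ⟨fun h => by simp [L.proj_of_mem h], fun h => h ▸ L.proj_mem i x⟩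

theorem eq_zero_of_mem_grade {i : ZMod 2} {x : L.carrier} (h : x ∈ L.grade i)
    (h' : x ∈ L.grade (i + 1)) : x = 0 :=
  Submodule.disjoint_def.1 (L.isCompl_grade' i).disjoint x h h'

theorem mem_grade_of_proj_eq_zero {i : ZMod 2} {x : L.carrier} (h : L.proj (i + 1) x = 0) :
    x ∈ L.grade i := by
  have hx := L.proj_add_proj x
  fin_cases i
  · have h : L.proj 1 x = 0 := h
    rw [h, add_zero] at hx
    exact hx ▸ L.proj_mem 0 x
  · have h : L.proj 0 x = 0 := h
    rw [h, zero_add] at hx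
    exact hx ▸ L.proj_mem 1 x

/-- An endomorphism preserving the grading commutes with the homogeneous projections. -/
theorem proj_comm {f : Module.End K L.carrier}
    (hf : ∀ i, ∀ x ∈ L.grade i, f x ∈ L.grade i) (i : ZMod 2) (x : L.carrier) :
    L.proj i (f x) = f (L.proj i x) := by
  induction x using L.homogeneous_induction with
  | hom j x hx =>
    rw [L.proj_of_mem hx, L.proj_of_mem (hf j x hx)]
    split_ifs <;> simp
  | add x y hx hy => simp [hx, hy]

/-- A linear map into a Lie superalgebra which sends homogeneous elements to homogeneous elements
of the same degree reflects degrees if it is injective. -/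
theorem mem_grade_of_map {M : Type*} [AddCommGroup M] [Module K M] {G : ZMod 2 → Submodule K M}
    (hG : ∀ i, ∀ x ∈ G i, x ∈ G (i + 1) → x = 0) (e : L.carrier →ₗ[K] M)
    (he : Function.Injective e) (h : ∀ i, ∀ x ∈ L.grade i, e x ∈ G i) (i : ZMod 2)
    (x : L.carrier) : x ∈ L.grade i ↔ e x ∈ G i := by
  refine ⟨h i x, fun hx => L.mem_grade_of_proj_eq_zero (he ?_)⟩
  have h1 : e (L.proj (i + 1) x) ∈ G (i + 1) := h _ _ (L.proj_mem _ x)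
  have h2 : L.proj (i + 1) x = x - L.proj i x := by
    have h0 := L.proj_add_proj x
    fin_cases i
    · exact eq_sub_of_add_eq' h0
    · exact eq_sub_of_add_eq h0
  rw [map_zero]
  -- The image of the component of degree `i + 1` also has degree `i`, being the difference of `e x`
  -- and the image of the other component.
  refine hG i _ ?_ h1
  rw [h2, map_sub]
  exact sub_mem hx (h _ _ (L.proj_mem _ x))

/-- The Jacobi identity with `y` moved to the right and one sign cleared. No remaining sign involves
the degree of `y`, so `y` need not be homogeneous. -/
theorem bracket_leibniz {i j : ZMod 2} {a x : L.carrier} (y : L.carrier) (ha : a ∈ L.grade i)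
    (hx : x ∈ L.grade j) :
    L.bracket a (L.bracket x y) =
      L.bracket (L.bracket a x) y + superSign K i j • L.bracket x (L.bracket a y) := by
  induction y using L.homogeneous_induction with
  | hom k y hy =>
    have h := L.bracket_jacobi ha hx hy
    rw [L.bracket_skew hy ha, L.bracket_skew hy (L.bracket_mem ha hx), map_neg, map_smul,
      superSign_add_right, superSign_comm K j i, superSign_comm K k i] at h
    have h' := congrArg (fun z => superSign K i k • z) h
    have e1 := superSign_mul_self K i k
    have e2 := superSign_mul_self K k j
    simp only [smul_add, smul_neg, smul_smul, smul_zero] at h'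
    rw [e1, one_smul, show superSign K i k * (superSign K i j * superSign K i k)
      = superSign K i j * (superSign K i k * superSign K i k) by ring,
      show superSign K i k * (superSign K k j * (superSign K i k * superSign K k j))
      = (superSign K i k * superSign K i k) * (superSign K k j * superSign K k j) by ring,
      e1, e2, mul_one, mul_one, one_smul] at h'
    rw [← sub_eq_zero, ← h']
    abel
  | add y z hy hz =>
    simp only [map_add, smul_add, hy, hz]
    abel

/-- The Lie superalgebra on the range of an even idempotent `p`, with bracket `p ∘ [·, ·]`. -/
@[reducible] noncomputable def compress (p : Module.End K L.carrier)
    (even : ∀ i, ∀ x ∈ L.grade i, p x ∈ L.grade i)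
    (compat : ∀ x y z, p (L.bracket (p x) (p (L.bracket (p y) (p z)))) =
      p (L.bracket (p x) (L.bracket (p y) (p z)))) : LieSuperalgebra.{u} K where
  carrier := LinearMap.range p
  grade i := (L.grade i).comap (LinearMap.range p).subtype
  isCompl_grade := by
    constructor
    · rw [Submodule.disjoint_def]
      intro x h0 h1
      exact Subtype.ext (L.eq_zero_of_mem_grade (i := 0) h0 h1)
    · rw [codisjoint_iff, eq_top_iff]
      rintro ⟨_, x, rfl⟩ -
      refine Submodule.mem_sup.2 ⟨⟨p (L.proj 0 x), _, rfl⟩, even 0 _ (L.proj_mem 0 x),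
        ⟨p (L.proj 1 x), _, rfl⟩, even 1 _ (L.proj_mem 1 x), Subtype.ext ?_⟩
      simp only [Submodule.coe_add, ← map_add, L.proj_add_proj]
  bracket := (L.bracket.compl₁₂ (LinearMap.range p).subtype (LinearMap.range p).subtype).compr₂
    p.rangeRestrict
  bracket_mem hx hy := even _ _ (L.bracket_mem hx hy)
  bracket_skew {i j x y} hx hy := by
    refine Subtype.ext ?_
    change p (L.bracket x y) = -(superSign K i j • p (L.bracket y x))
    have h : L.bracket x y = -(superSign K i j • L.bracket y x) := L.bracket_skew hx hy
    rw [h, map_neg, map_smul]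
  bracket_jacobi {i j k x y z} hx hy hz := by
    refine Subtype.ext ?_
    obtain ⟨_, x, rfl⟩ := x
    obtain ⟨_, y, rfl⟩ := y
    obtain ⟨_, z, rfl⟩ := z
    have h := L.bracket_jacobi hx hy hz
    change superSign K i k • p (L.bracket (p x) (p (L.bracket (p y) (p z))))
      + superSign K j i • p (L.bracket (p y) (p (L.bracket (p z) (p x))))
      + superSign K k j • p (L.bracket (p z) (p (L.bracket (p x) (p y)))) = 0
    -- Without the inner `p`, the sum is `p` applied to the Jacobi sum of `L`.
    rw [compat, compat, compat]
    simpa only [map_add, map_smul, map_zero, Submodule.subtype_apply] using congrArg p h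

variable {L}

theorem IsGradedIdeal.bracket_mem_left {I : Submodule K L.carrier} (hI : L.IsGradedIdeal I)
    {x : L.carrier} (hx : x ∈ I) (y : L.carrier) : L.bracket x y ∈ I := by
  have key : ∀ i j : ZMod 2, L.bracket (L.proj i x) (L.proj j y) ∈ I := fun i j => by
    rw [L.bracket_skew (L.proj_mem i x) (L.proj_mem j y)]
    exact I.neg_mem (I.smul_mem _ (hI.bracket_mem _ _ (hI.graded x hx i)))
  rw [← L.proj_add_proj x, ← L.proj_add_proj y]
  simp only [map_add, LinearMap.add_apply]
  exact I.add_mem (I.add_mem (key 0 0) (key 1 0)) (I.add_mem (key 0 1) (key 1 1))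

theorem IsGradedIdeal.inf {I J : Submodule K L.carrier} (hI : L.IsGradedIdeal I)
    (hJ : L.IsGradedIdeal J) : L.IsGradedIdeal (I ⊓ J) where
  graded x hx i := ⟨hI.graded x hx.1 i, hJ.graded x hx.2 i⟩
  bracket_mem x y hy := ⟨hI.bracket_mem x y hy.1, hJ.bracket_mem x y hy.2⟩

theorem isGradedIdeal_top : L.IsGradedIdeal ⊤ := ⟨fun _ _ _ => trivial, fun _ _ _ => trivial⟩

/-- A non-zero Lie superalgebra without proper graded ideals is simple or one-dimensional. -/
theorem simple_or_one_dimensional [Nontrivial L.carrier]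
    (h : ∀ I : Submodule K L.carrier, L.IsGradedIdeal I → I = ⊥ ∨ I = ⊤) :
    L.IsSimple ∨ L.IsOneDimensionalLieAlgebra ∨ L.IsOneDimensionalOdd := by
  by_cases hb : L.bracket = 0
  · obtain ⟨i, hi⟩ : ∃ i, L.grade i ≠ ⊥ := by
      by_contra! hi
      have := L.isCompl_grade.sup_eq_top
      rw [hi, hi, bot_sup_eq] at this
      exact bot_ne_top this
    obtain ⟨x, hx, hx0⟩ := Submodule.exists_mem_ne_zero_of_ne_bot hi
    -- With zero bracket every graded subspace is an ideal, in particular the line of a homogeneous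
    -- vector.
    have hspan : K ∙ x = ⊤ := by
      refine (h (K ∙ x) ⟨?_, fun y z _ => by simp [hb]⟩).resolve_left (by simpa using hx0)
      intro y hy j
      obtain ⟨c, rfl⟩ := Submodule.mem_span_singleton.1 hy
      rw [map_smul, L.proj_of_mem hx]
      split_ifs
      · exact hy
      · simp
    have hdim : Module.finrank K L.carrier = 1 := finrank_eq_one_iff'.2
      ⟨x, hx0, fun y => Submodule.mem_span_singleton.1 (hspan ▸ Submodule.mem_top)⟩
    have htop : L.grade i = ⊤ :=
      top_le_iff.1 (hspan ▸ (Submodule.span_singleton_le_iff_mem _ _).2 hx)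
    have hbot : L.grade (i + 1) = ⊥ := by
      have := (L.isCompl_grade' i).inf_eq_bot
      rwa [htop, top_inf_eq] at this
    fin_cases i
    · exact Or.inr (Or.inl ⟨hdim, hbot⟩)
    · exact Or.inr (Or.inr ⟨hdim, hbot⟩)
  · exact Or.inl ⟨hb, h⟩

end LieSuperalgebra

/-! ### Orthogonality for an even invariant form -/

namespace QuadraticLieSuperalgebra

variable {K : Type v} [Field K] (Q : QuadraticLieSuperalgebra.{u} K)

theorem form_eq_zero_of_ne {i j : ZMod 2} (hij : i ≠ j) {x y : Q.carrier} (hx : x ∈ Q.grade i)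
    (hy : y ∈ Q.grade j) : Q.form x y = 0 := by
  rcases (by decide : ∀ i j : ZMod 2, i ≠ j → (i = 0 ∧ j = 1) ∨ (i = 1 ∧ j = 0)) i j hij with
    ⟨rfl, rfl⟩ | ⟨rfl, rfl⟩
  · exact Q.form_even hx hy
  · rw [Q.form_supersymmetric hx hy, Q.form_even hy hx, mul_zero]

/-- An even form pairs only components of equal degree, so homogeneous projections are self-adjoint.
-/
theorem form_proj_left (i : ZMod 2) (x y : Q.carrier) :
    Q.form (Q.proj i x) y = Q.form x (Q.proj i y) := by
  have key : ∀ k l : ZMod 2, Q.form (Q.proj i (Q.proj k x)) (Q.proj l y) =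
      Q.form (Q.proj k x) (Q.proj i (Q.proj l y)) := fun k l => by
    rw [Q.proj_of_mem (Q.proj_mem k x), Q.proj_of_mem (Q.proj_mem l y)]
    by_cases hkl : k = l
    · subst hkl; split_ifs <;> simp
    · have := Q.form_eq_zero_of_ne hkl (Q.proj_mem k x) (Q.proj_mem l y)
      split_ifs <;> simp [this]
  conv_lhs => rw [← Q.proj_add_proj x, ← Q.proj_add_proj y]
  conv_rhs => rw [← Q.proj_add_proj x, ← Q.proj_add_proj y]
  simp only [map_add, LinearMap.add_apply, key]

/-- Orthogonality to a graded subspace is symmetric. -/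
theorem form_eq_zero_symm {I : Submodule K Q.carrier}
    (hI : ∀ x ∈ I, ∀ i, Q.proj i x ∈ I) {y : Q.carrier} :
    (∀ x ∈ I, Q.form x y = 0) ↔ ∀ x ∈ I, Q.form y x = 0 := by
  -- In a fixed degree, exchanging the arguments costs one invertible sign; gradedness of `I` allows
  -- working degree by degree.
  have key : ∀ x (i : ZMod 2), Q.form (Q.proj i y) x = superSign K i i * Q.form (Q.proj i x) y := by
    intro x i
    have e1 : Q.proj i (Q.proj i y) = Q.proj i y := Q.mem_grade_iff.1 (Q.proj_mem i y)
    have e2 : Q.proj i (Q.proj i x) = Q.proj i x := Q.mem_grade_iff.1 (Q.proj_mem i x)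
    rw [← e1, form_proj_left, Q.form_supersymmetric (Q.proj_mem i y) (Q.proj_mem i x),
      ← form_proj_left, e2]
  constructor
  · intro h x hx
    rw [← Q.proj_add_proj y, map_add, LinearMap.add_apply, key, key, h _ (hI x hx 0),
      h _ (hI x hx 1)]
    simp
  · intro h x hx
    have key' : ∀ i : ZMod 2, Q.form (Q.proj i x) y = 0 := fun i => by
      have := key x i
      rw [form_proj_left, h _ (hI x hx i)] at this
      exact (mul_eq_zero.1 this.symm).resolve_left (superSign_ne_zero K i i)
    rw [← Q.proj_add_proj x, map_add, LinearMap.add_apply, key', key', add_zero]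

theorem isGradedIdeal_orthogonal {I : Submodule K Q.carrier} (hI : Q.IsGradedIdeal I) :
    Q.IsGradedIdeal (Q.form.orthogonal I) where
  graded x hx i y hy := by
    rw [← form_proj_left]
    exact hx _ (hI.graded y hy i)
  bracket_mem x y hy z hz := by
    rw [← Q.form_invariant]
    exact hy _ (hI.bracket_mem_left hz x)

/-- `B([f, n], z) = B(f, [n, z])` vanishes because `I^⊥` is an ideal. With the next lemma: `I` and
`I^⊥` commute. -/
theorem bracket_orthogonal_right {I : Submodule K Q.carrier} (hI : Q.IsGradedIdeal I)
    {f n : Q.carrier} (hf : f ∈ I) (hn : n ∈ Q.form.orthogonal I) : Q.bracket f n = 0 := by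
  refine Q.form_nondegenerate.1 _ fun z => ?_
  rw [Q.form_invariant]
  exact (Q.isGradedIdeal_orthogonal hI).bracket_mem_left hn z f hf

theorem bracket_orthogonal_left {I : Submodule K Q.carrier} (hI : Q.IsGradedIdeal I)
    {f n : Q.carrier} (hf : f ∈ I) (hn : n ∈ Q.form.orthogonal I) : Q.bracket n f = 0 := by
  refine Q.form_nondegenerate.1 _ fun z => ?_
  rw [Q.form_invariant]
  exact (Q.form_eq_zero_symm hI.graded).1 hn _ (hI.bracket_mem_left hf z)

/-- If the form pairs the graded subspaces `I` and `M` perfectly, there is an even endomorphism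
with values in `I` which represents the functionals `B(x, ·)` on `M`. -/
theorem exists_even_representing {I M : Submodule K Q.carrier}
    (hI : ∀ x ∈ I, ∀ i, Q.proj i x ∈ I) (hM : ∀ x ∈ M, ∀ i, Q.proj i x ∈ M)
    (hIM : ∀ f ∈ I, (∀ m ∈ M, Q.form f m = 0) → f = 0)
    (hMI : ∀ m ∈ M, (∀ f ∈ I, Q.form f m = 0) → m = 0) :
    ∃ t : Module.End K Q.carrier, (∀ x, t x ∈ I) ∧
      (∀ x, ∀ m ∈ M, Q.form (t x) m = Q.form x m) ∧
      ∀ i, ∀ x ∈ Q.grade i, t x ∈ Q.grade i := by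
  let ρ : Q.carrier →ₗ[K] Module.Dual K M := Q.form.compl₁₂ LinearMap.id M.subtype
  have inj1 : Function.Injective (ρ ∘ₗ I.subtype) := by
    rw [← LinearMap.ker_eq_bot, LinearMap.ker_eq_bot']
    exact fun f hf => Subtype.ext (hIM f f.2 fun m hm => LinearMap.congr_fun hf ⟨m, hm⟩)
  have inj2 : Function.Injective (Q.form.flip.compl₁₂ M.subtype I.subtype) := by
    rw [← LinearMap.ker_eq_bot, LinearMap.ker_eq_bot']
    exact fun m hm => Subtype.ext (hMI m m.2 fun f hf => LinearMap.congr_fun hm ⟨f, hf⟩)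
  -- The injections `I → M*` and `M → I*` force equal dimensions, so the first is an isomorphism
  -- `e`; the map sought is `e⁻¹ ∘ ρ`.
  have h1 := LinearMap.finrank_le_finrank_of_injective inj1
  have h2 := LinearMap.finrank_le_finrank_of_injective inj2
  rw [Subspace.dual_finrank_eq] at h1 h2
  let e := LinearMap.linearEquivOfInjective _ inj1
    (by rw [Subspace.dual_finrank_eq]; exact le_antisymm h1 h2)
  have he : ∀ F (m : M), Q.form (e.symm F) m = F m := fun F m =>
    LinearMap.congr_fun (e.apply_symm_apply F) m
  have key : ∀ x, ∀ m ∈ M, Q.form (e.symm (ρ x)) m = Q.form x m := fun x m hm => he (ρ x) ⟨m, hm⟩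
  refine ⟨I.subtype ∘ₗ e.symm.toLinearMap ∘ₗ ρ, fun x => (e.symm (ρ x)).2, key, fun i x hx => ?_⟩
  -- The component of the wrong degree lies in `I` and is orthogonal to `M`.
  refine Q.mem_grade_of_proj_eq_zero (hIM _ (hI _ (e.symm (ρ x)).2 _) fun m hm => ?_)
  rw [form_proj_left]
  refine (key x _ (hM m hm _)).trans ?_
  exact Q.form_eq_zero_of_ne ((by decide : ∀ i : ZMod 2, i ≠ i + 1) i) hx (Q.proj_mem _ m)

/-- The quadratic Lie superalgebra on the range of an even idempotent. -/
@[reducible] noncomputable def compress (p : Module.End K Q.carrier) (idem : ∀ x, p (p x) = p x)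
    (even : ∀ i, ∀ x ∈ Q.grade i, p x ∈ Q.grade i)
    (compat : ∀ x y z, p (Q.bracket (p x) (p (Q.bracket (p y) (p z)))) =
      p (Q.bracket (p x) (Q.bracket (p y) (p z))))
    (self_adjoint : ∀ x y, Q.form (p x) y = Q.form x (p y)) :
    QuadraticLieSuperalgebra.{u} K where
  toLieSuperalgebra := Q.toLieSuperalgebra.compress p even compat
  form := Q.form.compl₁₂ (LinearMap.range p).subtype (LinearMap.range p).subtype
  form_supersymmetric hx hy := Q.form_supersymmetric hx hy
  form_even hx hy := Q.form_even hx hy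
  form_nondegenerate := by
    constructor
    · rintro ⟨_, x, rfl⟩ h
      refine Subtype.ext (Q.form_nondegenerate.1 _ fun y => ?_)
      -- As `p` is self-adjoint and idempotent, pairing `p x` with `p y` is the same as pairing it
      -- with `y`.
      have : Q.form (p x) (p y) = 0 := h ⟨p y, y, rfl⟩
      rwa [← self_adjoint, idem] at this
    · rintro ⟨_, x, rfl⟩ h
      refine Subtype.ext (Q.form_nondegenerate.2 _ fun y => ?_)
      have : Q.form (p y) (p x) = 0 := h ⟨p y, y, rfl⟩
      rwa [self_adjoint, idem] at this
  form_invariant := by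
    rintro ⟨_, x, rfl⟩ ⟨_, y, rfl⟩ ⟨_, z, rfl⟩
    change Q.form (p (Q.bracket (p x) (p y))) (p z) = Q.form (p x) (p (Q.bracket (p y) (p z)))
    rw [self_adjoint, idem, Q.form_invariant, ← self_adjoint, idem]

end QuadraticLieSuperalgebra

/-! ### From an isotropic splitting to a generalized double extension -/

namespace QuadraticLieSuperalgebra

variable {K : Type v} [Field K] {Q : QuadraticLieSuperalgebra.{u} K}

theorem isometric_refl (Q : QuadraticLieSuperalgebra.{u} K) : Isometric Q Q :=
  ⟨LinearEquiv.refl K _, fun _ _ => Iff.rfl, fun _ _ => rfl, fun _ _ => rfl⟩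

theorem gdeGrade_disjoint (P : QuadraticLieSuperalgebra.{u} K) (L : LieSuperalgebra.{u} K)
    (i : ZMod 2) : ∀ x ∈ P.gdeGrade L i, x ∈ P.gdeGrade L (i + 1) → x = 0 := by
  rintro ⟨A, X, F⟩ ⟨hA, hX, hF⟩ ⟨hA', hX', hF'⟩
  refine Prod.ext (L.eq_zero_of_mem_grade hA hA')
    (Prod.ext (P.eq_zero_of_mem_grade hX hX') ?_)
  have e1 : F ∘ₗ L.proj i = F := by simp [L.comp_proj_of_mem hF]
  have e2 : F ∘ₗ L.proj i = 0 := by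
    rw [L.comp_proj_of_mem hF', if_neg ((by decide : ∀ i : ZMod 2, i ≠ i + 1) i)]
  exact e1.symm.trans e2

/-- A decomposition `g = g₂ ⊕ g₁ ⊕ I` of a quadratic Lie superalgebra `g` along an isotropic graded
ideal `I`, with `I^⊥ = g₁ ⊕ I` and with `g₂` isotropic and orthogonal to `g₁`. -/
structure IsotropicSplitting (Q P : QuadraticLieSuperalgebra.{u} K) (L : LieSuperalgebra.{u} K)
    (I : Submodule K Q.carrier) where
  incl₂ : L.carrier →ₗ[K] Q.carrier
  incl₁ : P.carrier →ₗ[K] Q.carrier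
  proj₂ : Q.carrier →ₗ[K] L.carrier
  proj₁ : Q.carrier →ₗ[K] P.carrier
  incl₂_mem : ∀ i, ∀ A ∈ L.grade i, incl₂ A ∈ Q.grade i
  incl₁_mem : ∀ i, ∀ X ∈ P.grade i, incl₁ X ∈ Q.grade i
  proj₂_mem : ∀ i, ∀ x ∈ Q.grade i, proj₂ x ∈ L.grade i
  proj₁_mem : ∀ i, ∀ x ∈ Q.grade i, proj₁ x ∈ P.grade i
  proj₂_incl₂ : ∀ A, proj₂ (incl₂ A) = A
  proj₁_incl₁ : ∀ X, proj₁ (incl₁ X) = X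
  proj₁_incl₂ : ∀ A, proj₁ (incl₂ A) = 0
  proj₂_incl₁ : ∀ X, proj₂ (incl₁ X) = 0
  proj₂_of_mem : ∀ f ∈ I, proj₂ f = 0
  proj₁_of_mem : ∀ f ∈ I, proj₁ f = 0
  sub_mem : ∀ x, x - incl₂ (proj₂ x) - incl₁ (proj₁ x) ∈ I
  ideal : Q.IsGradedIdeal I
  mem_orthogonal_iff : ∀ x, x ∈ Q.form.orthogonal I ↔ proj₂ x = 0
  proj₂_bracket : ∀ A B, proj₂ (Q.bracket (incl₂ A) (incl₂ B)) = L.bracket A B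
  proj₁_bracket : ∀ X Y, proj₁ (Q.bracket (incl₁ X) (incl₁ Y)) = P.bracket X Y
  form_incl₁ : ∀ X Y, Q.form (incl₁ X) (incl₁ Y) = P.form X Y
  form_incl₂ : ∀ A B, Q.form (incl₂ A) (incl₂ B) = 0
  form_incl₁_incl₂ : ∀ X A, Q.form (incl₁ X) (incl₂ A) = 0
  exists_functional : ∀ F : Module.Dual K L.carrier, ∃ f ∈ I, ∀ A, Q.form f (incl₂ A) = F A

namespace IsotropicSplitting

variable {P : QuadraticLieSuperalgebra.{u} K} {L : LieSuperalgebra.{u} K}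
  {I : Submodule K Q.carrier} (s : IsotropicSplitting Q P L I)

/-- The functional `B(x, ·)` on `g₂`. -/
noncomputable def functional : Q.carrier →ₗ[K] Module.Dual K L.carrier :=
  Q.form.compl₁₂ LinearMap.id s.incl₂

theorem functional_apply (x : Q.carrier) (A : L.carrier) :
    s.functional x A = Q.form x (s.incl₂ A) := rfl

theorem functional_incl₂ (A : L.carrier) : s.functional (s.incl₂ A) = 0 :=
  LinearMap.ext (s.form_incl₂ A)

theorem functional_incl₁ (X : P.carrier) : s.functional (s.incl₁ X) = 0 :=
  LinearMap.ext (s.form_incl₁_incl₂ X)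

theorem functional_mem {i : ZMod 2} {x : Q.carrier} (hx : x ∈ Q.grade i) :
    s.functional x ∈ L.dualGrade i := by
  refine (Submodule.mem_dualAnnihilator _).2 fun A hA => ?_
  exact Q.form_eq_zero_of_ne ((by decide : ∀ i : ZMod 2, i ≠ i + 1) i) hx (s.incl₂_mem _ A hA)

/-- The component of an element in the isotropic ideal. -/
def remainder (x : Q.carrier) : Q.carrier := x - s.incl₂ (s.proj₂ x) - s.incl₁ (s.proj₁ x)

theorem remainder_mem (x : Q.carrier) : s.remainder x ∈ I := s.sub_mem x

theorem eq_add (x : Q.carrier) :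
    x = s.incl₂ (s.proj₂ x) + s.incl₁ (s.proj₁ x) + s.remainder x := by
  rw [remainder]; abel

theorem functional_remainder (x : Q.carrier) :
    s.functional (s.remainder x) = s.functional x := by
  rw [remainder, map_sub, map_sub, functional_incl₂, functional_incl₁, sub_zero, sub_zero]

theorem remainder_mem_grade {i : ZMod 2} {x : Q.carrier} (hx : x ∈ Q.grade i) :
    s.remainder x ∈ Q.grade i :=
  Submodule.sub_mem _ (Submodule.sub_mem _ hx (s.incl₂_mem _ _ (s.proj₂_mem _ _ hx)))
    (s.incl₁_mem _ _ (s.proj₁_mem _ _ hx))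

theorem incl₁_mem_orthogonal (X : P.carrier) : s.incl₁ X ∈ Q.form.orthogonal I :=
  (s.mem_orthogonal_iff _).2 (s.proj₂_incl₁ X)

theorem mem_orthogonal (s : IsotropicSplitting Q P L I) {f : Q.carrier} (hf : f ∈ I) :
    f ∈ Q.form.orthogonal I :=
  (s.mem_orthogonal_iff _).2 (s.proj₂_of_mem f hf)

theorem form_orthogonal_ideal (s : IsotropicSplitting Q P L I) {f n : Q.carrier} (hf : f ∈ I)
    (hn : n ∈ Q.form.orthogonal I) :
    Q.form n f = 0 := (Q.form_eq_zero_symm s.ideal.graded).1 hn f hf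

theorem proj₂_bracket_orthogonal (x : Q.carrier) {n : Q.carrier} (hn : n ∈ Q.form.orthogonal I) :
    s.proj₂ (Q.bracket x n) = 0 :=
  (s.mem_orthogonal_iff _).1 ((Q.isGradedIdeal_orthogonal s.ideal).bracket_mem x n hn)

theorem form_incl₂_incl₁ (A : L.carrier) (X : P.carrier) :
    Q.form (s.incl₂ A) (s.incl₁ X) = 0 := by
  induction A using L.homogeneous_induction with
  | hom i A hA =>
    induction X using P.homogeneous_induction with
    | hom j X hX =>
      rw [Q.form_supersymmetric (s.incl₂_mem _ _ hA) (s.incl₁_mem _ _ hX), s.form_incl₁_incl₂,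
        mul_zero]
    | add X Y hX hY => simp [hX, hY]
  | add A B hA hB => simp [hA, hB]

/-- The pairing with an element of `g₁` only sees the component in `g₁`. -/
theorem form_incl₁_left (X : P.carrier) (x : Q.carrier) :
    Q.form (s.incl₁ X) x = P.form X (s.proj₁ x) := by
  conv_lhs => rw [s.eq_add x]
  rw [map_add, map_add, s.form_incl₁_incl₂, s.form_incl₁,
    s.form_orthogonal_ideal (s.remainder_mem x) (s.incl₁_mem_orthogonal X), zero_add, add_zero]

theorem form_incl₁_right (X : P.carrier) (x : Q.carrier) :
    Q.form x (s.incl₁ X) = P.form (s.proj₁ x) X := by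
  conv_lhs => rw [s.eq_add x]
  rw [map_add, map_add, LinearMap.add_apply, LinearMap.add_apply, s.form_incl₂_incl₁, s.form_incl₁,
    (s.incl₁_mem_orthogonal X) _ (s.remainder_mem x), zero_add, add_zero]

/-- The pairing with an element of the ideal only sees the component in `g₂`. -/
theorem form_ideal_left {f : Q.carrier} (hf : f ∈ I) (x : Q.carrier) :
    Q.form f x = s.functional f (s.proj₂ x) := by
  conv_lhs => rw [s.eq_add x]
  rw [map_add, map_add, (s.mem_orthogonal (s.remainder_mem x)) _ hf,
    (s.incl₁_mem_orthogonal _) _ hf, add_zero, add_zero, functional_apply]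

/-- Of the nine terms only `g₂ × I`, `g₁ × g₁` and `I × g₂` survive. The first is not rewritten as a
functional, since exchanging its arguments needs homogeneity. -/
theorem form_apply (x y : Q.carrier) :
    Q.form x y = Q.form (s.incl₂ (s.proj₂ x)) (s.remainder y) +
      P.form (s.proj₁ x) (s.proj₁ y) + s.functional x (s.proj₂ y) := by
  conv_lhs => rw [s.eq_add x, s.eq_add y]
  simp only [map_add, LinearMap.add_apply, s.form_incl₂, s.form_incl₁_incl₂, s.form_incl₂_incl₁,
    s.form_incl₁, (s.incl₁_mem_orthogonal _) _ (s.remainder_mem x),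
    s.form_orthogonal_ideal (s.remainder_mem y) (s.incl₁_mem_orthogonal _),
    (s.mem_orthogonal (s.remainder_mem y)) _ (s.remainder_mem x),
    s.form_ideal_left (s.remainder_mem x), s.proj₂_incl₂, s.functional_remainder]
  ring

theorem bracket_eq_zero_left {f n : Q.carrier} (hf : f ∈ I) (hn : s.proj₂ n = 0) :
    Q.bracket f n = 0 :=
  Q.bracket_orthogonal_right s.ideal hf ((s.mem_orthogonal_iff n).2 hn)

theorem bracket_eq_zero_right {f n : Q.carrier} (hf : f ∈ I) (hn : s.proj₂ n = 0) :
    Q.bracket n f = 0 :=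
  Q.bracket_orthogonal_left s.ideal hf ((s.mem_orthogonal_iff n).2 hn)

/-- The action of `g₂` on `g₁`. -/
noncomputable def phi : L.carrier →ₗ[K] Module.End K P.carrier :=
  (Q.bracket.compl₁₂ s.incl₂ s.incl₁).compr₂ s.proj₁

theorem phi_apply (A : L.carrier) (X : P.carrier) :
    s.phi A X = s.proj₁ (Q.bracket (s.incl₂ A) (s.incl₁ X)) := rfl

/-- The component of the bracket of `g₂` in `g₁`. -/
noncomputable def psi : L.carrier →ₗ[K] L.carrier →ₗ[K] P.carrier :=
  (Q.bracket.compl₁₂ s.incl₂ s.incl₂).compr₂ s.proj₁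

theorem psi_apply (A B : L.carrier) :
    s.psi A B = s.proj₁ (Q.bracket (s.incl₂ A) (s.incl₂ B)) := rfl

/-- The component of the bracket of `g₂` in the ideal, as a functional. -/
noncomputable def omega : L.carrier →ₗ[K] L.carrier →ₗ[K] Module.Dual K L.carrier :=
  (Q.bracket.compl₁₂ s.incl₂ s.incl₂).compr₂ s.functional

theorem omega_apply (A B : L.carrier) :
    s.omega A B = s.functional (Q.bracket (s.incl₂ A) (s.incl₂ B)) := rfl

/-- Up to the sign of supersymmetry, `B([f, A], C) = B(f, [A, C])`, and `f` sees only the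
`g₂`-component of `[A, C]`. Thus `I` is `g₂*` with the coadjoint action. -/
theorem functional_bracket_ideal {i j : ZMod 2} {A : L.carrier} {f : Q.carrier}
    (hA : A ∈ L.grade i) (hf : f ∈ I) (hfj : f ∈ Q.grade j) :
    s.functional (Q.bracket (s.incl₂ A) f) = L.coadjoint A (s.functional f) := by
  rw [L.coadjoint_apply hA (s.functional_mem hfj), Q.bracket_skew (s.incl₂_mem _ _ hA) hfj,
    map_neg, map_smul]
  congr 2
  ext C
  rw [functional_apply, Q.form_invariant, s.form_ideal_left hf, s.proj₂_bracket]
  rfl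

/-- Invariance reduces this to `B(X, [A, C])`, where only `ψ(A, C)` counts. The two exchanges give
the signs `ij` and `j(i + k)`, leaving the `jk` of `χ`. -/
theorem functional_bracket_incl₁ {i j : ZMod 2} {A : L.carrier} {X : P.carrier}
    (hA : A ∈ L.grade i) (hX : X ∈ P.grade j) :
    s.functional (Q.bracket (s.incl₂ A) (s.incl₁ X)) = P.chi L s.psi A X := by
  ext C
  induction C using L.homogeneous_induction with
  | hom k C hC =>
    have hψ : s.psi A C ∈ P.grade (i + k) :=
      s.proj₁_mem _ _ (Q.bracket_mem (s.incl₂_mem _ _ hA) (s.incl₂_mem _ _ hC))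
    rw [P.chi_apply L s.psi A hX hC, functional_apply,
      Q.bracket_skew (s.incl₂_mem _ _ hA) (s.incl₁_mem _ _ hX), map_neg, map_smul,
      LinearMap.neg_apply, LinearMap.smul_apply, Q.form_invariant, s.form_incl₁_left, ← psi_apply,
      P.form_supersymmetric hX hψ, smul_eq_mul, superSign_add_right, superSign_comm K j i,
      ← mul_assoc, ← mul_assoc, superSign_mul_self, one_mul]
  | add C D hC hD => simp [hC, hD]

/-- Up to the sign of supersymmetry this is `B(C, [X, Y]) = B([C, X], Y)`, where only the
`g₁`-component `φ(C)(X)` counts. -/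
theorem functional_bracket_incl₁_incl₁ {i j : ZMod 2} {X Y : P.carrier}
    (hX : X ∈ P.grade i) (hY : Y ∈ P.grade j) :
    s.functional (Q.bracket (s.incl₁ X) (s.incl₁ Y)) = P.Phi L s.phi X Y := by
  ext C
  induction C using L.homogeneous_induction with
  | hom k C hC =>
    rw [P.Phi_apply L s.phi hX hY hC, functional_apply,
      Q.form_supersymmetric (Q.bracket_mem (s.incl₁_mem _ _ hX) (s.incl₁_mem _ _ hY))
        (s.incl₂_mem _ _ hC), ← Q.form_invariant, s.form_incl₁_right, ← phi_apply,
      superSign_comm]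
  | add C D hC hD => simp [hC, hD]

theorem proj₁_bracket_proj₁ (A : L.carrier) {n : Q.carrier} (hn : s.proj₂ n = 0) :
    s.proj₁ (Q.bracket (s.incl₂ A) n) = s.phi A (s.proj₁ n) := by
  conv_lhs => rw [s.eq_add n]
  rw [hn, map_zero, zero_add, map_add, map_add,
    s.proj₁_of_mem _ (s.ideal.bracket_mem _ _ (s.remainder_mem n)), add_zero, phi_apply]

/-- `I` commutes with `I^⊥`, so projecting `I^⊥` to `g₁` respects brackets. -/
theorem proj₁_bracket_of_orthogonal {m n : Q.carrier} (hm : s.proj₂ m = 0) (hn : s.proj₂ n = 0) :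
    s.proj₁ (Q.bracket m n) = P.bracket (s.proj₁ m) (s.proj₁ n) := by
  conv_lhs => rw [s.eq_add m, s.eq_add n]
  simp only [hm, hn, map_zero, zero_add, map_add, LinearMap.add_apply,
    s.bracket_eq_zero_right (s.remainder_mem n) (s.proj₂_incl₁ _),
    s.bracket_eq_zero_left (s.remainder_mem m) (s.proj₂_incl₁ _),
    s.bracket_eq_zero_left (s.remainder_mem m) (s.proj₂_of_mem _ (s.remainder_mem n)),
    s.proj₁_bracket, add_zero]

theorem proj₁_bracket_incl₂ (A : L.carrier) (x : Q.carrier) :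
    s.proj₁ (Q.bracket (s.incl₂ A) x) = s.psi A (s.proj₂ x) + s.phi A (s.proj₁ x) := by
  conv_lhs => rw [s.eq_add x]
  simp only [map_add, s.proj₁_of_mem _ (s.ideal.bracket_mem _ _ (s.remainder_mem x)), add_zero,
    psi_apply, phi_apply]

theorem functional_bracket_incl₂ {i j : ZMod 2} {A : L.carrier} {x : Q.carrier}
    (hA : A ∈ L.grade i) (hx : x ∈ Q.grade j) :
    s.functional (Q.bracket (s.incl₂ A) x) =
      s.omega A (s.proj₂ x) + P.chi L s.psi A (s.proj₁ x) + L.coadjoint A (s.functional x) := by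
  conv_lhs => rw [s.eq_add x]
  rw [map_add, map_add, map_add, map_add, s.functional_bracket_incl₁ hA (s.proj₁_mem _ _ hx),
    s.functional_bracket_ideal hA (s.remainder_mem x) (s.remainder_mem_grade hx),
    s.functional_remainder, omega_apply]

/-- The Leibniz rule is that of `ad A` on `I^⊥`, projected to `g₁`; antisymmetry is invariance of
the form. -/
theorem phi_mem {a : ZMod 2} {A : L.carrier} (hA : A ∈ L.grade a) :
    P.IsSkewSuperderivation a (s.phi A) where
  map_mem hX := s.proj₁_mem _ _ (Q.bracket_mem (s.incl₂_mem _ _ hA) (s.incl₁_mem _ _ hX))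
  leibniz {i X} Y hX := by
    have h := congrArg s.proj₁
      (Q.bracket_leibniz (s.incl₁ Y) (s.incl₂_mem _ _ hA) (s.incl₁_mem _ _ hX))
    have z : ∀ (x : Q.carrier) (X : P.carrier), s.proj₂ (Q.bracket x (s.incl₁ X)) = 0 :=
      fun x X => s.proj₂_bracket_orthogonal x (s.incl₁_mem_orthogonal X)
    rw [s.proj₁_bracket_proj₁ A (z _ _), s.proj₁_bracket, map_add, map_smul,
      s.proj₁_bracket_of_orthogonal (z _ _) (s.proj₂_incl₁ Y),
      s.proj₁_bracket_of_orthogonal (s.proj₂_incl₁ X) (z _ _), s.proj₁_incl₁, s.proj₁_incl₁] at h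
    exact h
  skew {i X} Y hX := by
    rw [phi_apply, ← s.form_incl₁_right, Q.bracket_skew (s.incl₂_mem _ _ hA) (s.incl₁_mem _ _ hX),
      map_neg, map_smul, LinearMap.neg_apply, LinearMap.smul_apply, Q.form_invariant,
      s.form_incl₁_left, smul_eq_mul, phi_apply]

theorem psi_skew {a b : ZMod 2} {A B : L.carrier} (hA : A ∈ L.grade a) (hB : B ∈ L.grade b) :
    s.psi A B = -(superSign K a b • s.psi B A) := by
  rw [psi_apply, Q.bracket_skew (s.incl₂_mem _ _ hA) (s.incl₂_mem _ _ hB), map_neg, map_smul,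
    psi_apply]

/-- The context of generalized double extension defined by a splitting. -/
noncomputable def context : GDEContext P L where
  φ := s.phi
  ψ := s.psi
  w := s.omega
  φ_mem := s.phi_mem
  ψ_mem hA hB := s.proj₁_mem _ _ (Q.bracket_mem (s.incl₂_mem _ _ hA) (s.incl₂_mem _ _ hB))
  ψ_skew := s.psi_skew
  w_mem hA hB := s.functional_mem (Q.bracket_mem (s.incl₂_mem _ _ hA) (s.incl₂_mem _ _ hB))
  w_skew hA hB := by
    rw [omega_apply, Q.bracket_skew (s.incl₂_mem _ _ hA) (s.incl₂_mem _ _ hB), map_neg, map_smul,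
      omega_apply]
  twisted_morphism {a b A B} hA hB := by
    ext X
    have z : ∀ (x : Q.carrier) (X : P.carrier), s.proj₂ (Q.bracket x (s.incl₁ X)) = 0 :=
      fun x X => s.proj₂_bracket_orthogonal x (s.incl₁_mem_orthogonal X)
    have h := congrArg s.proj₁
      (Q.bracket_leibniz (s.incl₁ X) (s.incl₂_mem _ _ hA) (s.incl₂_mem _ _ hB))
    -- Acting on `g₁`, the `g₁`-part of `[A, B]` yields `ad ψ(A, B)`, and the `I`-part acts by zero:
    -- this is the defect of `φ` from being a morphism.
    rw [s.eq_add (Q.bracket (s.incl₂ A) (s.incl₂ B)), map_add Q.bracket, map_add Q.bracket,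
      LinearMap.add_apply, LinearMap.add_apply,
      s.bracket_eq_zero_left (s.remainder_mem _) (s.proj₂_incl₁ _), add_zero, map_add, map_add,
      map_smul, s.proj₁_bracket_proj₁ A (z _ _), s.proj₁_bracket_proj₁ B (z _ _), s.proj₁_bracket,
      s.proj₂_bracket, ← phi_apply, ← phi_apply, ← phi_apply, ← psi_apply] at h
    simp only [LinearMap.sub_apply, LinearMap.comp_apply, LinearMap.smul_apply, h]
    abel
  ψ_cyclic {a b c A B C} hA hB hC := by
    -- The `g₁`-component of the Jacobi identity on `g₂`.
    have h := congrArg s.proj₁ (Q.bracket_jacobi (s.incl₂_mem _ _ hA) (s.incl₂_mem _ _ hB)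
      (s.incl₂_mem _ _ hC))
    simp only [map_add, map_smul, map_zero, s.proj₁_bracket_incl₂, s.proj₂_bracket,
      s.proj₂_incl₂, s.proj₁_incl₂, add_zero] at h
    rw [s.psi_skew hA (L.bracket_mem hB hC), s.psi_skew hB (L.bracket_mem hC hA),
      s.psi_skew hC (L.bracket_mem hA hB)] at h
    have e : ∀ i j k, superSign K i j * (superSign K i k * superSign K i j) = superSign K i k :=
      fun i j k => by rw [mul_left_comm, superSign_mul_self, mul_one]
    simp only [superSign_add_right, smul_add, smul_neg, smul_smul, e] at h
    rw [superSign_comm K c a, superSign_comm K a b, superSign_comm K b c, ← h]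
    simp only [smul_sub, superSign_comm K c a, superSign_comm K b a, superSign_comm K c b]
    abel
  w_cocycle {a b c A B C} hA hB hC := by
    -- The `I`-component of the same identity.
    have h := congrArg s.functional (Q.bracket_jacobi (s.incl₂_mem _ _ hA) (s.incl₂_mem _ _ hB)
      (s.incl₂_mem _ _ hC))
    simp only [map_add, map_smul, map_zero] at h
    rw [s.functional_bracket_incl₂ hA (Q.bracket_mem (s.incl₂_mem _ _ hB) (s.incl₂_mem _ _ hC)),
      s.functional_bracket_incl₂ hB (Q.bracket_mem (s.incl₂_mem _ _ hC) (s.incl₂_mem _ _ hA)),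
      s.functional_bracket_incl₂ hC (Q.bracket_mem (s.incl₂_mem _ _ hA) (s.incl₂_mem _ _ hB))] at h
    simp only [s.proj₂_bracket, ← s.psi_apply, ← s.omega_apply] at h
    rw [superSign_comm K c a, superSign_comm K a b, superSign_comm K b c, ← h]
    simp only [smul_add]
    abel
  w_supercyclic {a b c A B C} hA hB hC := by
    -- `B([A, B], C) = B(A, [B, C])`, then supersymmetry.
    rw [omega_apply, functional_apply, Q.form_invariant,
      Q.form_supersymmetric (s.incl₂_mem _ _ hA)
        (Q.bracket_mem (s.incl₂_mem _ _ hB) (s.incl₂_mem _ _ hC)), superSign_comm]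
    rfl

/-- The decomposition `g ≃ g₂ ⊕ g₁ ⊕ g₂*`. -/
noncomputable def toProd :
    Q.carrier →ₗ[K] L.carrier × P.carrier × Module.Dual K L.carrier :=
  s.proj₂.prod (s.proj₁.prod s.functional)

theorem toProd_apply (x : Q.carrier) :
    s.toProd x = (s.proj₂ x, s.proj₁ x, s.functional x) := rfl

theorem toProd_bijective : Function.Bijective s.toProd := by
  constructor
  · rw [← LinearMap.ker_eq_bot, LinearMap.ker_eq_bot']
    intro x hx
    have h2 : s.proj₂ x = 0 := congrArg Prod.fst hx
    have h1 : s.proj₁ x = 0 := congrArg (fun y => y.2.1) hx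
    have h0 : s.functional x = 0 := congrArg (fun y => y.2.2) hx
    refine Q.form_nondegenerate.1 x fun y => ?_
    rw [s.form_apply, h2, h1, h0]
    simp
  · rintro ⟨A, X, F⟩
    obtain ⟨f, hf, hF⟩ := s.exists_functional F
    refine ⟨s.incl₂ A + s.incl₁ X + f, ?_⟩
    rw [toProd_apply]
    simp only [map_add, s.proj₂_incl₂, s.proj₂_incl₁, s.proj₂_of_mem f hf, s.proj₁_incl₂,
      s.proj₁_incl₁, s.proj₁_of_mem f hf, functional_incl₂, functional_incl₁, add_zero, zero_add]
    rw [show s.functional f = F from LinearMap.ext hF]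

theorem isGeneralizedDoubleExtension (s : IsotropicSplitting Q P L I) :
    IsGeneralizedDoubleExtension Q P L := by
  refine ⟨s.context, LinearEquiv.ofBijective s.toProd s.toProd_bijective,
    Q.mem_grade_of_map (P.gdeGrade_disjoint L) _ s.toProd_bijective.1 fun i x hx =>
      ⟨s.proj₂_mem i x hx, s.proj₁_mem i x hx, s.functional_mem hx⟩, ?_, ?_⟩
  · intro i j x y hx hy
    have hA := s.proj₂_mem i x hx
    have hX := s.proj₁_mem i x hx
    have hf := s.remainder_mem_grade hx
    have hB := s.proj₂_mem j y hy
    have hY := s.proj₁_mem j y hy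
    have hg := s.remainder_mem_grade hy
    -- The products `g₁ × I`, `I × g₁` and `I × I` vanish, and `g₁ × g₂` and `I × g₂` are turned
    -- around, so that each remaining `g₂` factor split off stands on the left, as the component
    -- formulas require.
    have key : Q.bracket x y = Q.bracket (s.incl₂ (s.proj₂ x)) y
        + Q.bracket (s.incl₁ (s.proj₁ x)) (s.incl₁ (s.proj₁ y))
        - superSign K i j • Q.bracket (s.incl₂ (s.proj₂ y)) (s.incl₁ (s.proj₁ x))
        - superSign K i j • Q.bracket (s.incl₂ (s.proj₂ y)) (s.remainder x) := by
      conv_lhs => rw [s.eq_add x, map_add, map_add, LinearMap.add_apply, LinearMap.add_apply]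
      rw [show Q.bracket (s.incl₁ (s.proj₁ x)) y
          = Q.bracket (s.incl₁ (s.proj₁ x)) (s.incl₁ (s.proj₁ y))
            - superSign K i j • Q.bracket (s.incl₂ (s.proj₂ y)) (s.incl₁ (s.proj₁ x)) by
        conv_lhs => rw [s.eq_add y, map_add, map_add,
          s.bracket_eq_zero_right (s.remainder_mem y) (s.proj₂_incl₁ _),
          Q.bracket_skew (s.incl₁_mem _ _ hX) (s.incl₂_mem _ _ hB)]
        abel,
        show Q.bracket (s.remainder x) y
          = - (superSign K i j • Q.bracket (s.incl₂ (s.proj₂ y)) (s.remainder x)) by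
        conv_lhs => rw [s.eq_add y, map_add, map_add,
          s.bracket_eq_zero_left (s.remainder_mem x) (s.proj₂_incl₁ _),
          s.bracket_eq_zero_left (s.remainder_mem x) (s.proj₂_of_mem _ (s.remainder_mem y)),
          Q.bracket_skew hf (s.incl₂_mem _ _ hB)]
        abel]
      abel
    change s.toProd (Q.bracket x y) = s.context.bracket i j (s.toProd x) (s.toProd y)
    rw [key, toProd_apply]
    refine Prod.ext ?_ (Prod.ext ?_ ?_)
    · change s.proj₂ _ = L.bracket (s.proj₂ x) (s.proj₂ y)
      conv_lhs => rw [s.eq_add y]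
      simp only [map_add, map_sub, map_smul, s.proj₂_bracket,
        s.proj₂_bracket_orthogonal _ (s.incl₁_mem_orthogonal _),
        s.proj₂_bracket_orthogonal _ (s.mem_orthogonal (s.remainder_mem _)), s.proj₂_incl₂,
        s.proj₂_incl₁, s.proj₂_of_mem _ (s.remainder_mem _), add_zero, smul_zero, sub_zero]
    · change s.proj₁ _ = P.bracket (s.proj₁ x) (s.proj₁ y) + s.psi (s.proj₂ x) (s.proj₂ y)
        + s.phi (s.proj₂ x) (s.proj₁ y) - superSign K i j • s.phi (s.proj₂ y) (s.proj₁ x)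
      simp only [map_add, map_sub, map_smul, s.proj₁_bracket, s.proj₁_bracket_incl₂,
        s.proj₁_incl₁, s.proj₂_incl₁, s.proj₂_of_mem _ (s.remainder_mem _),
        s.proj₁_of_mem _ (s.remainder_mem _), map_zero, add_zero, zero_add, smul_zero, sub_zero]
      abel
    · change s.functional _ = P.Phi L s.phi (s.proj₁ x) (s.proj₁ y)
        + L.coadjoint (s.proj₂ x) (s.functional y)
        - superSign K i j • L.coadjoint (s.proj₂ y) (s.functional x)
        + P.chi L s.psi (s.proj₂ x) (s.proj₁ y)
        - superSign K i j • P.chi L s.psi (s.proj₂ y) (s.proj₁ x)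
        + s.omega (s.proj₂ x) (s.proj₂ y)
      rw [map_sub, map_sub, map_add, map_smul, map_smul, s.functional_bracket_incl₂ hA hy,
        s.functional_bracket_incl₁_incl₁ hX hY, s.functional_bracket_incl₁ hB hX,
        s.functional_bracket_ideal hB (s.remainder_mem x) hf, s.functional_remainder]
      abel
  · intro i j x y hx hy
    change Q.form x y = P.form (s.proj₁ x) (s.proj₁ y) + s.functional x (s.proj₂ y)
      + superSign K i j * s.functional y (s.proj₂ x)
    rw [s.form_apply, Q.form_supersymmetric (s.incl₂_mem _ _ (s.proj₂_mem _ _ hx))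
      (s.remainder_mem_grade hy), ← functional_apply, s.functional_remainder]
    ring

end IsotropicSplitting

end QuadraticLieSuperalgebra

/-! ### Even projections and isotropic complements -/

namespace LieSuperalgebra

variable {K : Type v} [Field K] (L : LieSuperalgebra.{u} K)

/-- A graded subspace is the range of an even idempotent. -/
theorem exists_even_projection {N : Submodule K L.carrier}
    (hN : ∀ x ∈ N, ∀ i, L.proj i x ∈ N) :
    ∃ q : Module.End K L.carrier, (∀ x, q x ∈ N) ∧ (∀ x ∈ N, q x = x) ∧
      ∀ i, ∀ x ∈ L.grade i, q x ∈ L.grade i := by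
  obtain ⟨g, hg⟩ := N.subtype.exists_leftInverse_of_injective N.ker_subtype
  have hg' : ∀ x, ∀ hx : x ∈ N, (g x : L.carrier) = x := fun x hx =>
    congrArg Subtype.val (LinearMap.congr_fun hg ⟨x, hx⟩)
  let q : Module.End K L.carrier := N.subtype ∘ₗ g
  -- The even part of an arbitrary projection `q` onto `N`; it still projects onto `N` because `N`
  -- is graded.
  refine ⟨L.proj 0 ∘ₗ q ∘ₗ L.proj 0 + L.proj 1 ∘ₗ q ∘ₗ L.proj 1, fun x => ?_, fun x hx => ?_,
    fun i x hx => ?_⟩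
  · exact N.add_mem (hN _ (g _).2 0) (hN _ (g _).2 1)
  · have h : ∀ i, L.proj i (q (L.proj i x)) = L.proj i x := fun i => by
      rw [show q (L.proj i x) = L.proj i x from hg' _ (hN x hx i)]
      exact L.mem_grade_iff.1 (L.proj_mem i x)
    simp only [LinearMap.add_apply, LinearMap.comp_apply, h, L.proj_add_proj]
  · simp only [LinearMap.add_apply, LinearMap.comp_apply, L.proj_of_mem hx]
    rcases (by decide : ∀ i : ZMod 2, i = 0 ∨ i = 1) i with rfl | rfl
    · simpa using L.proj_mem 0 (q x)
    · simpa using L.proj_mem 1 (q x)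

end LieSuperalgebra

namespace QuadraticLieSuperalgebra

variable {K : Type v} [Field K] {Q : QuadraticLieSuperalgebra.{u} K}

theorem exists_form_eq (F : Module.Dual K Q.carrier) : ∃ x, ∀ y, Q.form x y = F y :=
  ⟨(Q.form.toDual Q.form_nondegenerate).symm F, fun y =>
    LinearMap.congr_fun ((Q.form.toDual Q.form_nondegenerate).apply_symm_apply F) y⟩

/-- A subspace with trivial left orthogonal is everything. -/
theorem eq_top_of_orthogonal {J : Submodule K Q.carrier}
    (h : ∀ x, (∀ y ∈ J, Q.form x y = 0) → x = 0) : J = ⊤ := by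
  by_contra hJ
  obtain ⟨F, hF, hJF⟩ := Submodule.exists_le_ker_of_lt_top J (lt_top_iff_ne_top.2 hJ)
  obtain ⟨x, hx⟩ := exists_form_eq F
  have hx0 : x = 0 := h x fun y hy => (hx y).trans (hJF hy)
  exact hF (LinearMap.ext fun y => by rw [← hx, hx0, map_zero])

/-- An even idempotent whose kernel is the orthogonal of an isotropic graded ideal. -/
structure IsTransversal (I : Submodule K Q.carrier) (p : Module.End K Q.carrier) : Prop where
  even : ∀ i, ∀ x ∈ Q.grade i, p x ∈ Q.grade i
  idem : ∀ x, p (p x) = p x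
  mem_orthogonal_iff : ∀ x, x ∈ Q.form.orthogonal I ↔ p x = 0

theorem exists_isTransversal {I : Submodule K Q.carrier} (hI : Q.IsGradedIdeal I) :
    ∃ p : Module.End K Q.carrier, IsTransversal I p := by
  obtain ⟨q, hq, hqN, hqe⟩ := Q.exists_even_projection (Q.isGradedIdeal_orthogonal hI).graded
  refine ⟨LinearMap.id - q, ⟨fun i x hx => Submodule.sub_mem _ hx (hqe i x hx), fun x => ?_,
    fun x => ?_⟩⟩
  · simp [hqN _ (hq x)]
  · rw [LinearMap.sub_apply, LinearMap.id_apply, sub_eq_zero]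
    exact ⟨fun hx => (hqN x hx).symm, fun hx => hx ▸ hq x⟩

namespace IsTransversal

variable {I : Submodule K Q.carrier} {p : Module.End K Q.carrier}

theorem sub_mem_orthogonal (hp : IsTransversal I p) (x : Q.carrier) :
    x - p x ∈ Q.form.orthogonal I := by
  rw [hp.mem_orthogonal_iff, map_sub, hp.idem, sub_self]

theorem form_apply_right (hp : IsTransversal I p) {f : Q.carrier} (hf : f ∈ I) (x : Q.carrier) :
    Q.form f (p x) = Q.form f x := by
  have h : Q.form f (x - p x) = 0 := hp.sub_mem_orthogonal x f hf
  rw [map_sub, sub_eq_zero] at h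
  exact h.symm

theorem eq_zero (hp : IsTransversal I p) {f : Q.carrier} (hf : f ∈ I)
    (h : ∀ x, Q.form f (p x) = 0) : f = 0 :=
  Q.form_nondegenerate.1 f fun x => by rw [← hp.form_apply_right hf, h]

theorem range_graded (hp : IsTransversal I p) :
    ∀ x ∈ LinearMap.range p, ∀ i, Q.proj i x ∈ LinearMap.range p := by
  rintro _ ⟨x, rfl⟩ i
  exact ⟨Q.proj i x, (Q.proj_comm hp.even i x).symm⟩

/-- The range of `p` is a copy of `g/I^⊥`, hence perfectly paired with `I`. -/
theorem exists_even_representing (hp : IsTransversal I p) (hI : Q.IsGradedIdeal I) :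
    ∃ t : Module.End K Q.carrier, (∀ x, t x ∈ I) ∧
      (∀ x y, Q.form (t x) (p y) = Q.form x (p y)) ∧
      ∀ i, ∀ x ∈ Q.grade i, t x ∈ Q.grade i := by
  obtain ⟨t, ht, htp, hte⟩ := Q.exists_even_representing hI.graded hp.range_graded
    (fun f hf h => hp.eq_zero hf fun x => h _ ⟨x, rfl⟩)
    (by
      rintro _ ⟨x, rfl⟩ h
      rw [← hp.idem]
      exact (hp.mem_orthogonal_iff _).1 fun f hf => h f hf)
  exact ⟨t, ht, fun x y => htp x _ ⟨y, rfl⟩, hte⟩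

end IsTransversal

/-- The orthogonal of an isotropic graded ideal has an isotropic graded complement. -/
theorem exists_isTransversal_isotropic (h2 : (2 : K) ≠ 0) {I : Submodule K Q.carrier}
    (hI : Q.IsGradedIdeal I) (hiso : I ≤ Q.form.orthogonal I) :
    ∃ s : Module.End K Q.carrier, IsTransversal I s ∧ ∀ x y, Q.form (s x) (s y) = 0 := by
  obtain ⟨p, hp⟩ := exists_isTransversal hI
  obtain ⟨θ, hθI, hθ, hθe⟩ := hp.exists_even_representing hI
  have hpθ : ∀ x, p (θ x) = 0 := fun x => (hp.mem_orthogonal_iff _).1 (hiso (hθI x))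
  have hθ' : ∀ x y, Q.form (p x) (θ (p y)) = Q.form (p x) (p y) := by
    intro x y
    induction x using Q.homogeneous_induction with
    | hom i x hx =>
      induction y using Q.homogeneous_induction with
      | hom j y hy =>
        have hpx := hp.even i x hx
        have hpy := hp.even j y hy
        rw [Q.form_supersymmetric hpx (hθe j _ hpy), hθ, ← Q.form_supersymmetric hpx hpy]
      | add y z hy hz => simp [hy, hz]
    | add x z hx hz => simp [hx, hz]
  -- Shifting by half of `θ ∘ p` subtracts half of `B(p x, p y)` in each argument; the quadratic
  -- correction vanishes as `I` is isotropic.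
  let s : Module.End K Q.carrier := p - (2 : K)⁻¹ • (θ ∘ₗ p)
  have hs : ∀ x, s x = p x - (2 : K)⁻¹ • θ (p x) := fun x => rfl
  have hps : ∀ x, p (s x) = p x := fun x => by
    rw [hs, map_sub, map_smul, hp.idem, hpθ, smul_zero, sub_zero]
  refine ⟨s, ⟨fun i x hx => ?_, fun x => ?_, fun x => ?_⟩, fun x y => ?_⟩
  · have hpx := hp.even i x hx
    exact Submodule.sub_mem _ hpx (Submodule.smul_mem _ _ (hθe i _ hpx))
  · rw [hs (s x), hps, ← hs]
  · rw [hp.mem_orthogonal_iff]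
    constructor
    · intro hx
      rw [hs, hx, map_zero, smul_zero, sub_zero]
    · intro hx
      rw [← hps, hx, map_zero]
  · have h0 : Q.form (θ (p x)) (θ (p y)) = 0 := hiso (hθI _) _ (hθI _)
    simp only [hs, map_sub, map_smul, LinearMap.sub_apply, LinearMap.smul_apply, hθ, hθ', h0,
      smul_eq_mul]
    field_simp
    ring

/-! ### Minimal ideals that are isotropic -/

/-- Along an isotropic graded ideal, a quadratic Lie superalgebra is a generalized double
extension. -/
theorem exists_isGeneralizedDoubleExtension (h2 : (2 : K) ≠ 0) {I : Submodule K Q.carrier}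
    (hI : Q.IsGradedIdeal I) (hI0 : I ≠ ⊥) (hiso : I ≤ Q.form.orthogonal I)
    (hmin : ∀ J : Submodule K Q.carrier, Q.IsGradedIdeal J → J ≤ I → J = ⊥ ∨ J = I) :
    ∃ (P : QuadraticLieSuperalgebra.{u} K) (L : LieSuperalgebra.{u} K),
      Module.finrank K P.carrier < Module.finrank K Q.carrier ∧
      (L.IsSimple ∨ L.IsOneDimensionalLieAlgebra ∨ L.IsOneDimensionalOdd) ∧
      IsGeneralizedDoubleExtension Q P L := by
  obtain ⟨s, hs, hss⟩ := exists_isTransversal_isotropic h2 hI hiso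
  obtain ⟨t, htI, hts, hte⟩ := hs.exists_even_representing hI
  have hN := Q.isGradedIdeal_orthogonal hI
  have st : ∀ f ∈ I, s f = 0 := fun f hf => (hs.mem_orthogonal_iff f).1 (hiso hf)
  have tt : ∀ f ∈ I, t f = f := fun f hf => sub_eq_zero.1 <|
    hs.eq_zero (I.sub_mem (htI f) hf) fun x => by
      rw [map_sub, LinearMap.sub_apply, hts, sub_self]
  have ts : ∀ x, t (s x) = 0 := fun x => hs.eq_zero (htI _) fun y => by rw [hts, hss]
  -- `s`, `r`, `t` are complementary even projections onto `g₂`, `g₁ = (g₂ ⊕ I)^⊥` and `I`.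
  let r : Module.End K Q.carrier := LinearMap.id - s - t
  have hr : ∀ x, r x = x - s x - t x := fun x => rfl
  have hx : ∀ x, x = s x + r x + t x := fun x => by rw [hr]; abel
  have sr : ∀ x, s (r x) = 0 := fun x => by
    rw [hr, map_sub, map_sub, hs.idem, st _ (htI x), sub_self, sub_zero]
  have tr : ∀ x, t (r x) = 0 := fun x => by
    rw [hr, map_sub, map_sub, ts, tt _ (htI x), sub_zero, sub_self]
  have rs : ∀ x, r (s x) = 0 := fun x => by rw [hr, hs.idem, ts, sub_self, sub_zero]
  have rf : ∀ f ∈ I, r f = 0 := fun f hf => by rw [hr, st f hf, tt f hf, sub_zero, sub_self]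
  have rr : ∀ x, r (r x) = r x := fun x => by rw [hr (r x), sr, tr, sub_zero, sub_zero]
  have rN : ∀ x, r x ∈ Q.form.orthogonal I := fun x => (hs.mem_orthogonal_iff _).2 (sr x)
  have re : ∀ i, ∀ x ∈ Q.grade i, r x ∈ Q.grade i := fun i x hx =>
    Submodule.sub_mem _ (Submodule.sub_mem _ hx (hs.even i x hx)) (hte i x hx)
  have Brs : ∀ x y, Q.form (r x) (s y) = 0 := fun x y => by
    simp only [hr, map_sub, LinearMap.sub_apply, hss, hts, sub_zero, sub_self]
  have Bsr : ∀ x y, Q.form (s y) (r x) = 0 := fun x y =>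
    (Q.form_eq_zero_symm hs.range_graded).2 (by rintro _ ⟨y, rfl⟩; exact Brs x y) _ ⟨y, rfl⟩
  have Brt : ∀ x, ∀ f ∈ I, Q.form (r x) f = 0 := fun x =>
    (Q.form_eq_zero_symm hI.graded).1 (rN x)
  have Btr : ∀ x, ∀ f ∈ I, Q.form f (r x) = 0 := rN
  -- The kernel of `s` is the ideal `I^⊥`, so `s` computes the bracket of `g/I^⊥`.
  have s_bracket : ∀ x y, s (Q.bracket x (s y)) = s (Q.bracket x y) := fun x y => by
    have h := (hs.mem_orthogonal_iff _).1 (hN.bracket_mem x _ (hs.sub_mem_orthogonal y))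
    rw [map_sub, map_sub, sub_eq_zero] at h
    exact h.symm
  have s_bracket' : ∀ x y, s (Q.bracket (s x) y) = s (Q.bracket x y) := fun x y => by
    have h := (hs.mem_orthogonal_iff _).1 (hN.bracket_mem_left (hs.sub_mem_orthogonal x) y)
    rw [map_sub, LinearMap.sub_apply, map_sub, sub_eq_zero] at h
    exact h.symm
  -- `[r y, r z]` lies in `I^⊥`, and its `I`-component commutes with `r x`.
  have r_compat : ∀ x y z, r (Q.bracket (r x) (r (Q.bracket (r y) (r z)))) =
      r (Q.bracket (r x) (Q.bracket (r y) (r z))) := fun x y z => by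
    have h : s (Q.bracket (r y) (r z)) = 0 :=
      (hs.mem_orthogonal_iff _).1 (hN.bracket_mem _ _ (rN z))
    conv_rhs => rw [hx (Q.bracket (r y) (r z)), h, zero_add, map_add,
      Q.bracket_orthogonal_left hI (htI _) (rN x), add_zero]
  have r_adj : ∀ x y, Q.form (r x) y = Q.form x (r y) := fun x y => by
    have h1 : Q.form (r x) y = Q.form (r x) (r y) := by
      conv_lhs => rw [hx y, map_add, map_add, Brs, Brt x _ (htI y), zero_add, add_zero]
    have h2 : Q.form x (r y) = Q.form (r x) (r y) := by
      conv_lhs => rw [hx x, map_add, map_add, LinearMap.add_apply, LinearMap.add_apply, Bsr,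
        Btr y _ (htI x), zero_add, add_zero]
    rw [h1, h2]
  let P := Q.compress r rr re r_compat r_adj
  let L := Q.toLieSuperalgebra.compress s hs.even fun x y z => s_bracket _ _
  have splitting : IsotropicSplitting Q P L I :=
    { incl₂ := (LinearMap.range s).subtype
      incl₁ := (LinearMap.range r).subtype
      proj₂ := s.rangeRestrict
      proj₁ := r.rangeRestrict
      incl₂_mem := fun i A hA => hA
      incl₁_mem := fun i A hA => hA
      proj₂_mem := hs.even
      proj₁_mem := re
      proj₂_incl₂ := by rintro ⟨_, x, rfl⟩; exact Subtype.ext (hs.idem x)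
      proj₁_incl₁ := by rintro ⟨_, x, rfl⟩; exact Subtype.ext (rr x)
      proj₁_incl₂ := by rintro ⟨_, x, rfl⟩; exact Subtype.ext (rs x)
      proj₂_incl₁ := by rintro ⟨_, x, rfl⟩; exact Subtype.ext (sr x)
      proj₂_of_mem := fun f hf => Subtype.ext (st f hf)
      proj₁_of_mem := fun f hf => Subtype.ext (rf f hf)
      sub_mem := fun x => by
        have h : x - s x - r x = t x := by rw [hr]; abel
        exact h ▸ htI x
      ideal := hI
      mem_orthogonal_iff := fun x => (hs.mem_orthogonal_iff x).trans
        ⟨fun h => Subtype.ext h, fun h => congrArg Subtype.val h⟩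
      proj₂_bracket := fun _ _ => rfl
      proj₁_bracket := fun _ _ => rfl
      form_incl₁ := fun _ _ => rfl
      form_incl₂ := by rintro ⟨_, x, rfl⟩ ⟨_, y, rfl⟩; exact hss x y
      form_incl₁_incl₂ := by rintro ⟨_, x, rfl⟩ ⟨_, y, rfl⟩; exact Brs x y
      exists_functional := fun F => by
        obtain ⟨x, hx⟩ := exists_form_eq (Q := Q) (F ∘ₗ s.rangeRestrict)
        refine ⟨t x, htI x, ?_⟩
        rintro ⟨_, y, rfl⟩
        refine (hts x y).trans ((hx _).trans (congrArg F (Subtype.ext (hs.idem y)))) }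
  obtain ⟨f, hf, hf0⟩ := Submodule.exists_mem_ne_zero_of_ne_bot hI0
  refine ⟨P, L, ?_, ?_, splitting.isGeneralizedDoubleExtension⟩
  · refine Submodule.finrank_lt (fun h => hf0 ?_)
    obtain ⟨x, rfl⟩ : f ∈ LinearMap.range r := h ▸ Submodule.mem_top
    rw [← tt _ hf, tr]
  · have : Nontrivial L.carrier := by
      by_contra hL
      rw [not_nontrivial_iff_subsingleton] at hL
      refine hf0 (hs.eq_zero hf fun x => ?_)
      have : s x = 0 := congrArg Subtype.val (Subsingleton.elim (s.rangeRestrict x) 0)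
      rw [this, map_zero]
    -- Pull `J` back to a graded ideal of `g` containing `I^⊥`; its orthogonal lies in `I`, and
    -- minimality applies to it.
    refine L.simple_or_one_dimensional fun J hJ => ?_
    have hsJ : ∀ i x, s.rangeRestrict (Q.proj i x) = L.proj i (s.rangeRestrict x) := by
      intro i x
      induction x using Q.homogeneous_induction with
      | hom j x hx =>
        have hx' : s.rangeRestrict x ∈ L.grade j := hs.even j x hx
        rw [Q.proj_of_mem hx, L.proj_of_mem hx']
        split_ifs
        · rfl
        · exact map_zero _
      | add x y hx hy => simp only [map_add, hx, hy]
    have hJ' : Q.IsGradedIdeal (J.comap s.rangeRestrict) :=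
      { graded := fun x hx i => by
          rw [Submodule.mem_comap, hsJ]
          exact hJ.graded _ hx i
        bracket_mem := fun x y hy => by
          have h : s.rangeRestrict (Q.bracket x y) =
              L.bracket (s.rangeRestrict x) (s.rangeRestrict y) := Subtype.ext (by
            change s (Q.bracket x y) = s (Q.bracket (s x) (s y))
            rw [s_bracket, s_bracket'])
          rw [Submodule.mem_comap, h]
          exact hJ.bracket_mem _ _ hy }
    have hNJ : ∀ n ∈ Q.form.orthogonal I, n ∈ J.comap s.rangeRestrict := fun n hn => by
      have : s.rangeRestrict n = 0 := Subtype.ext ((hs.mem_orthogonal_iff n).1 hn)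
      rw [Submodule.mem_comap, this]
      exact J.zero_mem
    have hle : Q.form.orthogonal (J.comap s.rangeRestrict) ≤ I := by
      intro x hxJ
      have h1 := (Q.form_eq_zero_symm hJ'.graded).1 hxJ
      -- `x` and `t x` agree as functionals on `g₂` by the choice of `t`, and both vanish on `I^⊥`.
      have h2 : x - t x = 0 := Q.form_nondegenerate.1 _ fun y => by
        conv_lhs => rw [hx y, add_assoc, map_add]
        have hn : r y + t y ∈ Q.form.orthogonal I :=
          Submodule.add_mem _ (rN y) (hiso (htI y))
        rw [map_sub, LinearMap.sub_apply, LinearMap.sub_apply, hts, sub_self, zero_add,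
          h1 _ (hNJ _ hn), hn _ (htI x), sub_self]
      rw [sub_eq_zero.1 h2]
      exact htI x
    -- Orthogonal zero means that the pullback is `g`, so `J` is everything; orthogonal `I` puts the
    -- pullback inside `I^⊥ = ker s`, so `J = 0`.
    rcases hmin _ (Q.isGradedIdeal_orthogonal hJ') hle with h | h
    · right
      have htop : J.comap s.rangeRestrict = ⊤ := eq_top_of_orthogonal fun x hxJ => by
        have : x ∈ Q.form.orthogonal (J.comap s.rangeRestrict) :=
          (Q.form_eq_zero_symm hJ'.graded).2 hxJ
        rwa [h, Submodule.mem_bot] at this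
      refine eq_top_iff.2 ?_
      rintro ⟨_, x, rfl⟩ -
      have : x ∈ J.comap s.rangeRestrict := htop ▸ Submodule.mem_top
      exact this
    · left
      refine eq_bot_iff.2 ?_
      rintro ⟨_, x, rfl⟩ hxJ
      have hxJ' : x ∈ J.comap s.rangeRestrict := hxJ
      have : x ∈ Q.form.orthogonal I := (Q.form_eq_zero_symm hI.graded).2 fun g hg => by
        rw [← h] at hg
        exact hg x hxJ'
      exact Subtype.ext ((hs.mem_orthogonal_iff x).1 this)

/-! ### Minimal ideals on which the form is non-degenerate -/

/-- A graded ideal on which the form is non-degenerate splits off orthogonally. -/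
theorem exists_isOrthogonalDirectSum {I : Submodule K Q.carrier} (hI : Q.IsGradedIdeal I)
    (hI0 : I ≠ ⊥) (hI1 : I ≠ ⊤) (hdisj : I ⊓ Q.form.orthogonal I = ⊥) :
    ∃ P R : QuadraticLieSuperalgebra.{u} K,
      Module.finrank K P.carrier < Module.finrank K Q.carrier ∧
      Module.finrank K R.carrier < Module.finrank K Q.carrier ∧
      IsOrthogonalDirectSum Q P R := by
  have hzero : ∀ f ∈ I, f ∈ Q.form.orthogonal I → f = 0 := fun f hf hf' =>
    (Submodule.mem_bot K).1 (hdisj ▸ ⟨hf, hf'⟩)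
  have hzero' : ∀ f ∈ I, (∀ m ∈ I, Q.form f m = 0) → f = 0 := fun f hf h =>
    hzero f hf ((Q.form_eq_zero_symm hI.graded).2 h)
  -- Pairing `I` with itself makes `t` the orthogonal projection onto `I`.
  obtain ⟨t, htI, htf, hte⟩ := Q.exists_even_representing hI.graded hI.graded hzero' hzero
  have tt : ∀ f ∈ I, t f = f := fun f hf => sub_eq_zero.1 <|
    hzero' _ (I.sub_mem (htI f) hf) fun m hm => by
      rw [map_sub, LinearMap.sub_apply, htf f m hm, sub_self]
  let r : Module.End K Q.carrier := LinearMap.id - t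
  have hr : ∀ x, r x = x - t x := fun x => rfl
  have hx : ∀ x, x = t x + r x := fun x => by rw [hr]; abel
  have rN : ∀ x, r x ∈ Q.form.orthogonal I := fun x =>
    (Q.form_eq_zero_symm hI.graded).2 fun m hm => by
      rw [hr, map_sub, LinearMap.sub_apply, htf x m hm, sub_self]
  have Brt : ∀ x, ∀ f ∈ I, Q.form (r x) f = 0 := fun x =>
    (Q.form_eq_zero_symm hI.graded).1 (rN x)
  have tr : ∀ x, t (r x) = 0 := fun x => by rw [hr, map_sub, tt _ (htI x), sub_self]
  have rr : ∀ x, r (r x) = r x := fun x => by rw [hr (r x), tr, sub_zero]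
  have re : ∀ i, ∀ x ∈ Q.grade i, r x ∈ Q.grade i := fun i x hx =>
    Submodule.sub_mem _ hx (hte i x hx)
  have form_eq : ∀ x y, Q.form x y = Q.form (t x) (t y) + Q.form (r x) (r y) := fun x y => by
    conv_lhs => rw [hx x, hx y]
    simp only [map_add, LinearMap.add_apply, Brt x _ (htI y), rN y _ (htI x), add_zero, zero_add]
  have bracket_eq : ∀ x y, Q.bracket x y = Q.bracket (t x) (t y) + Q.bracket (r x) (r y) :=
    fun x y => by
      conv_lhs => rw [hx x, hx y]
      simp only [map_add, LinearMap.add_apply, Q.bracket_orthogonal_right hI (htI x) (rN y),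
        Q.bracket_orthogonal_left hI (htI y) (rN x), add_zero, zero_add]
  have tb : ∀ x y, t (Q.bracket x (t y)) = Q.bracket x (t y) := fun x y =>
    tt _ (hI.bracket_mem x _ (htI y))
  have rb : ∀ x y, t (Q.bracket x (r y)) = 0 := fun x y => by
    have hN : Q.bracket x (r y) ∈ Q.form.orthogonal I :=
      (Q.isGradedIdeal_orthogonal hI).bracket_mem _ _ (rN y)
    refine hzero' _ (htI _) fun m hm => ?_
    rw [htf _ m hm]
    exact (Q.form_eq_zero_symm hI.graded).1 hN m hm
  let P := Q.compress t (fun x => tt _ (htI x)) hte (fun x y z => by rw [tb (t y) z])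
    (fun x y => by
      rw [form_eq (t x) y, form_eq x (t y), tt _ (htI x), tt _ (htI y), hr (t x), hr (t y),
        tt _ (htI x), tt _ (htI y), sub_self, sub_self]
      simp)
  let R := Q.compress r rr re (fun x y z => by
      rw [hr (Q.bracket (r y) (r z)), rb, sub_zero])
    (fun x y => by
      rw [form_eq (r x) y, form_eq x (r y), tr, tr, rr, rr]
      simp)
  let e : Q.carrier →ₗ[K] P.carrier × R.carrier := t.rangeRestrict.prod r.rangeRestrict
  have he : Function.Bijective e := by
    constructor
    · rw [← LinearMap.ker_eq_bot, LinearMap.ker_eq_bot']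
      intro x h
      have h1 : t x = 0 := congrArg (fun y => (y.1 : Q.carrier)) h
      have h2 : r x = 0 := congrArg (fun y => (y.2 : Q.carrier)) h
      rw [hx x, h1, h2, add_zero]
    · rintro ⟨⟨_, x, rfl⟩, ⟨_, y, rfl⟩⟩
      refine ⟨t x + r y, Prod.ext (Subtype.ext ?_) (Subtype.ext ?_)⟩
      · change t (t x + r y) = t x
        rw [map_add, tr, tt _ (htI x), add_zero]
      · change r (t x + r y) = r y
        rw [map_add, rr, hr (t x), tt _ (htI x), sub_self, zero_add]
  refine ⟨P, R, ?_, ?_, LinearEquiv.ofBijective e he, ?_, ?_, ?_⟩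
  · refine Submodule.finrank_lt (fun h => hI1 ?_)
    rw [eq_top_iff, ← h]
    rintro _ ⟨x, rfl⟩
    exact htI x
  · obtain ⟨f, hf, hf0⟩ := Submodule.exists_mem_ne_zero_of_ne_bot hI0
    refine Submodule.finrank_lt (fun h => hf0 ?_)
    obtain ⟨x, rfl⟩ : f ∈ LinearMap.range r := h ▸ Submodule.mem_top
    rw [← tt _ hf, tr]
  · refine Q.mem_grade_of_map (G := fun i => (P.grade i).prod (R.grade i)) ?_ _ he.1
      fun i x hx => ⟨hte i x hx, re i x hx⟩
    rintro i ⟨x, y⟩ ⟨hx, hy⟩ ⟨hx', hy'⟩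
    exact Prod.ext (P.eq_zero_of_mem_grade hx hx') (R.eq_zero_of_mem_grade hy hy')
  · intro x y
    refine Prod.ext (Subtype.ext ?_) (Subtype.ext ?_)
    · change t (Q.bracket x y) = t (Q.bracket (t x) (t y))
      rw [bracket_eq x y, map_add, rb, add_zero]
    · change r (Q.bracket x y) = r (Q.bracket (r x) (r y))
      rw [bracket_eq x y, map_add, hr (Q.bracket (t x) (t y)), tb, sub_self, zero_add]
  · exact form_eq

/-! ### The induction on dimension -/

theorem not_isOneDimensionalOdd (h2 : (2 : K) ≠ 0) : ¬ Q.IsOneDimensionalOdd := by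
  rintro ⟨hdim, h0⟩
  obtain ⟨x, hx0, hx⟩ := finrank_eq_one_iff'.1 hdim
  have hmem : ∀ y, y ∈ Q.grade 1 := fun y => by
    have := Q.isCompl_grade.sup_eq_top
    rw [h0, bot_sup_eq] at this
    exact this ▸ Submodule.mem_top
  -- On odd vectors supersymmetry reads `B(x, x) = -B(x, x)`.
  have hxx : Q.form x x = 0 := by
    have h := Q.form_supersymmetric (hmem x) (hmem x)
    have h1 : superSign K 1 1 = -1 := by simp [superSign, ZMod.val_one]
    rw [h1, neg_one_mul, eq_neg_iff_add_eq_zero, ← two_mul] at h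
    exact (mul_eq_zero.1 h).resolve_left h2
  refine hx0 (Q.form_nondegenerate.1 x fun y => ?_)
  obtain ⟨c, rfl⟩ := hx y
  rw [map_smul, hxx, smul_zero]

/-- Lets the two summands of an orthogonal sum share the union of their finite sets of building
blocks. -/
theorem ObtainedFrom.mono {S T : Set (QuadraticLieSuperalgebra.{u} K)} (hST : S ⊆ T)
    (h : ObtainedFrom S Q) : ObtainedFrom T Q := by
  induction h with
  | base hP hQ => exact .base (hST hP) hQ
  | orthogonalSum _ _ h hP hQ => exact .orthogonalSum hP hQ h
  | extension L _ hL h hP => exact .extension L hP hL h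

theorem MemB.exists_obtainedFrom (h : Q.MemB) :
    ∃ S : Set (QuadraticLieSuperalgebra.{u} K),
      S.Finite ∧ (∀ P ∈ S, P.MemB) ∧ ObtainedFrom S Q :=
  ⟨{Q}, Set.finite_singleton Q, fun _ hP => hP ▸ h, .base rfl (isometric_refl Q)⟩

theorem exists_obtainedFrom (h2 : (2 : K) ≠ 0) (Q : QuadraticLieSuperalgebra.{u} K) :
    ∃ S : Set (QuadraticLieSuperalgebra.{u} K),
      S.Finite ∧ (∀ P ∈ S, P.MemB) ∧ ObtainedFrom S Q := by
  induction hn : Module.finrank K Q.carrier using Nat.strong_induction_on generalizing Q with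
  | _ n ih =>
  subst hn
  rcases subsingleton_or_nontrivial Q.carrier with hQ | hQ
  · exact MemB.exists_obtainedFrom (Or.inl hQ)
  obtain ⟨I, ⟨hI, hI0⟩, hmin⟩ := wellFounded_lt.has_min
    {I : Submodule K Q.carrier | Q.IsGradedIdeal I ∧ I ≠ ⊥}
    ⟨⊤, LieSuperalgebra.isGradedIdeal_top, top_ne_bot⟩
  have hmin' : ∀ J : Submodule K Q.carrier, Q.IsGradedIdeal J → J ≤ I → J = ⊥ ∨ J = I := by
    intro J hJ hJI
    by_contra! h
    exact hmin J ⟨hJ, h.1⟩ (lt_of_le_of_ne hJI h.2)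
  rcases hmin' _ (hI.inf (Q.isGradedIdeal_orthogonal hI)) inf_le_left with h | h
  · by_cases hI1 : I = ⊤
    · subst hI1
      refine MemB.exists_obtainedFrom (Or.inr ?_)
      rcases LieSuperalgebra.simple_or_one_dimensional fun J hJ => hmin' J hJ le_top with
        hs | h1 | h1
      · exact Or.inl hs
      · exact Or.inr h1
      · exact (not_isOneDimensionalOdd h2 h1).elim
    · obtain ⟨P, R, hP, hR, hsum⟩ := exists_isOrthogonalDirectSum hI hI0 hI1 h
      obtain ⟨S, hS, hSB, hSP⟩ := ih _ hP P rfl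
      obtain ⟨T, hT, hTB, hTR⟩ := ih _ hR R rfl
      exact ⟨S ∪ T, hS.union hT, fun A hA => hA.elim (hSB A) (hTB A),
        .orthogonalSum (hSP.mono Set.subset_union_left) (hTR.mono Set.subset_union_right) hsum⟩
  · obtain ⟨P, L, hP, hL, hext⟩ :=
      exists_isGeneralizedDoubleExtension h2 hI hI0 (inf_eq_left.1 h) hmin'
    obtain ⟨S, hS, hSB, hSP⟩ := ih _ hP P rfl
    exact ⟨S, hS, hSB, .extension L hSP hL hext⟩

end QuadraticLieSuperalgebra

theorem mainTheorem2 {K : Type v} [Field K] [IsAlgClosed K] [CharZero K]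
    (Q : QuadraticLieSuperalgebra.{u} K) :
    Q.MemB ∨
      ∃ S : Set (QuadraticLieSuperalgebra.{u} K),
        S.Finite ∧ (∀ P ∈ S, P.MemB) ∧ QuadraticLieSuperalgebra.ObtainedFrom S Q :=
  -- The second alternative covers everything: a member of `𝓑` is obtained from itself with no
  -- construction step.
  Or.inr (Q.exists_obtainedFrom two_ne_zero)
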